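/- Let $k$ be an algebraically closed field of characteristic $0$, let $P=k[x,y,z,t]$ with its standard grading $P=\bigoplus_{n\ge 0}P_n$, and let $I\subset P$ be a homogeneous ideal. Here $I$ is called saturated if $f\in I$ whenever $(x,y,z,t)^N f\subset I$ for some $N$; $I$ is said to define a subscheme of $\mathbb{P}^3_k$ with Hilbert polynomial $4n$ if $\dim_k (P/I)_n=4n$ for all sufficiently large $n$; and the (Castelnuovo–Mumford) regularity of $I$ is the least integer $m$ such that $I$ has a graded free resolution $\cdots\to F_1\to F_0\to I\to 0$ by finitely generated graded free modules $F_i$ that are generated in degrees $\le m+i$ for all $i\ge 0$. Then the following are equivalent: 1. $I$ is saturated, it defines a subscheme of $\mathbb{P}^3_k$ with Hilbert polynomial $4n$, and its regularity is $4$. 2. There are linear forms $\ell,\ell_1,\ell_2\in P_1$ with $\ell\neq 0$ and $\ell_1,\ell_2$ linearly independent, a quadratic form $q\in P_2$ with $q\notin(\ell_1,\ell_2)$, and a quartic form $p\in P_4$ with $p\in(\ell_1,\ell_2,q)$ and $p\notin(\ell)$, such that $$I=\ell\cdot(\ell_1,\ell_2,q)+(p)=(\ell\ell_1,\ell\ell_2,\ell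 q,p).$$ In particular, a saturated homogeneous ideal $I$ with Hilbert polynomial $4n$ (of $P/I$) has regularity $4$ if and only if it has the form in 2. -/

import Mathlib

open MvPolynomial Matrix

noncomputable section

namespace SpaceCurves

variable (k : Type*) [Field k]

/-- The homogeneous coordinate ring `P = k[x, y, z, t]` of projective 3-space. -/
abbrev CoordRing : Type _ := MvPolynomial (Fin 4) k

/-- The irrelevant maximal ideal `(x, y, z, t)`. -/
def irrelevantIdeal : Ideal (CoordRing k) :=
  Ideal.span (Set.range (fun i : Fin 4 => (X i : CoordRing k)))

variable {k}

/-- `I` is a homogeneous ideal for the standard grading by total degree: it contains the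
homogeneous components of its elements. -/
def IsHomogeneousIdeal (I : Ideal (CoordRing k)) : Prop :=
  ∀ f ∈ I, ∀ n : ℕ, homogeneousComponent n f ∈ I

/-- `I` is saturated: if some power of the irrelevant ideal multiplies `f` into `I`, then `f ∈ I`.
The saturated homogeneous ideals correspond to the closed subschemes of projective 3-space
(to their ideal sheaves) through `I = ⨁ₙ H⁰(ℐ(n))`. -/
def IsSaturated (I : Ideal (CoordRing k)) : Prop :=
  ∀ (f : CoordRing k) (N : ℕ), (∀ g ∈ irrelevantIdeal k ^ N, g * f ∈ I) → f ∈ I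

/-- The Hilbert function `n ↦ dim_k (P_n / I_n)` of `P / I`, where `I_n = I ∩ P_n`. -/
def hilbertFunction (I : Ideal (CoordRing k)) (n : ℕ) : ℕ :=
  Module.finrank k
    (homogeneousSubmodule (Fin 4) k n ⧸
      (I.restrictScalars k).comap (homogeneousSubmodule (Fin 4) k n).subtype)

/-- `P / I`, that is the subscheme defined by `I`, has Hilbert polynomial `h`. -/
def HasHilbertPolynomial (I : Ideal (CoordRing k)) (h : Polynomial ℚ) : Prop :=
  ∀ᶠ n : ℕ in Filter.atTop, (hilbertFunction I n : ℚ) = h.eval (n : ℚ)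

/-- A graded free resolution `⋯ → F₂ → F₁ → F₀ → I → 0` of the ideal `I` by finitely generated
graded free modules `F i = ⨁ⱼ P(-deg i j)`, with homogeneous maps of degree zero, in coordinates:
`aug` is the row of the map `F₀ → P` (with image `I`) and `mat i` is the matrix of the map
`F (i + 1) → F i`. -/
structure GradedFreeResolution (I : Ideal (CoordRing k)) where
  /-- the rank of `F i` -/
  rank : ℕ → ℕ
  /-- the degrees of the basis elements of `F i` -/
  deg : (i : ℕ) → Fin (rank i) → ℕ
  /-- the images of the basis elements of `F 0` in `I` -/
  aug : Fin (rank 0) → CoordRing k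
  /-- the matrix of `F (i + 1) → F i` -/
  mat : (i : ℕ) → Matrix (Fin (rank i)) (Fin (rank (i + 1))) (CoordRing k)
  aug_homogeneous : ∀ r, (aug r).IsHomogeneous (deg 0 r)
  /-- the entry `(r, s)` is zero or homogeneous of degree `deg (i + 1) s - deg i r ≥ 0` -/
  mat_homogeneous : ∀ i r s, mat i r s ≠ 0 →
    ∃ e : ℕ, (mat i r s).IsHomogeneous e ∧ e + deg i r = deg (i + 1) s
  span_aug : Ideal.span (Set.range aug) = I
  exact_zero : ∀ v : Fin (rank 0) → CoordRing k,
    aug ⬝ᵥ v = 0 ↔ ∃ w : Fin (rank 1) → CoordRing k, mat 0 *ᵥ w = v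
  exact_succ : ∀ (i : ℕ) (v : Fin (rank (i + 1)) → CoordRing k),
    mat i *ᵥ v = 0 ↔ ∃ w : Fin (rank (i + 2)) → CoordRing k, mat (i + 1) *ᵥ w = v

/-- `I` is `m`-regular in the sense of Castelnuovo and Mumford: it has a graded free resolution
whose `i`-th module is generated in degrees at most `m + i`, for all `i ≥ 0`. -/
def IsRegular (I : Ideal (CoordRing k)) (m : ℤ) : Prop :=
  ∃ F : GradedFreeResolution I, ∀ (i : ℕ) (j : Fin (F.rank i)), (F.deg i j : ℤ) ≤ m + i

/-- The Castelnuovo-Mumford regularity of `I` is `m`: the least `m` for which `I` is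
`m`-regular. -/
def HasRegularity (I : Ideal (CoordRing k)) (m : ℤ) : Prop :=
  IsLeast {m : ℤ | IsRegular I m} m

end SpaceCurves

end

open MvPolynomial Matrix

noncomputable section

namespace SpaceCurves

variable {k : Type*} [Field k]

/-! ### Homogeneous components and homogeneous ideals -/

section Graded

attribute [local instance] MvPolynomial.gradedAlgebra

/-! The main tool is the residual sequence `0 → (P/(I : l))(-1) → P/I → P/(I + (l)) → 0` of a plane
`l`, used through the identity of Hilbert functions `hilbertFunction_sup_span`.

Let `I` be saturated with Hilbert polynomial 4n. A linear form that is a nonzerodivisor modulo `I`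
cuts out a scheme of length 4, whose saturated ideal has Hilbert function at least min(n + 1, 4).
Hence the Hilbert function of `P/I` grows by at least 4 at every step from degree 2 on, and so
cannot exceed 4n for any n ≥ 2 (`hilbertFunction_le_four_mul`). In degree 2 it is at most 8, while
`P₂` has dimension 10, so `I` contains two independent quadrics.

If these form a regular sequence, `I` is their complete intersection, which is 3-regular
(`eq_completeIntersection`). Otherwise they are `l * l₁` and `l * l₂`, and `K = I : l` contains `l₁`
and `l₂`. If `K = (l₁, l₂)`, a dimension count gives a cubic `c` in `I` outside `(l)`, and `I =
l(l₁, l₂) + (c)` is again 3-regular. If `K` is larger, its Hilbert function is bounded. By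
4-regularity some generator `p` of degree at most 4 lies outside `(l)`; the Hilbert polynomial
forces degree 4 and `I + (l) = (l, p)`. Then `K` defines a scheme of length 2 on a line, so `K =
(l₁, l₂, q)` and `I = lK + (p)` (`exists_form_of_common_factor`). The equality `I + (l) = (l, p)`
comes from depth: `P/(l, p)` has depth two, so a strictly larger homogeneous ideal has a Hilbert
function smaller by a linearly growing amount, whereas the difference here is bounded.

Conversely, `I : l = (l₁, l₂, q)` and `I + (l) = (l, p)` give saturation and the Hilbert polynomial,
and a resolution of length two built from Koszul relations gives 4-regularity. With lower regularity
all generators would have degree at most 3; being in `(l, p)` they would lie in `(l)`, contrary to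
`p ∉ (l)`. -/

theorem homogeneousComponent_mul_add (a : CoordRing k) {f : CoordRing k} {d : ℕ}
    (hf : f.IsHomogeneous d) (n : ℕ) :
    homogeneousComponent (n + d) (a * f) = homogeneousComponent n a * f := by
  have h := DirectSum.coe_decompose_mul_add_of_right_mem
    (homogeneousSubmodule (Fin 4) k) (i := n) (j := d) (a := a) (b := f) hf
  have e : ∀ (g : CoordRing k) (m : ℕ),
      ((DirectSum.decompose (homogeneousSubmodule (Fin 4) k) g) m : CoordRing k) =
        homogeneousComponent m g := fun g m => decomposition.decompose'_apply g m
  rwa [e, e] at h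

theorem homogeneousComponent_mul_of_lt (a : CoordRing k) {f : CoordRing k} {d n : ℕ}
    (hf : f.IsHomogeneous d) (hn : n < d) :
    homogeneousComponent n (a * f) = 0 := by
  have h := DirectSum.coe_decompose_mul_of_right_mem_of_not_le
    (homogeneousSubmodule (Fin 4) k) (i := d) (n := n) (a := a) (b := f) hf (by omega)
  have e : ∀ (g : CoordRing k) (m : ℕ),
      ((DirectSum.decompose (homogeneousSubmodule (Fin 4) k) g) m : CoordRing k) =
        homogeneousComponent m g := fun g m => decomposition.decompose'_apply g m
  rwa [e] at h

end Graded

theorem homogeneousComponent_self {f : CoordRing k} {n : ℕ} (hf : f.IsHomogeneous n) :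
    homogeneousComponent n f = f := homogeneousComponent_eq_self hf

theorem isHomogeneousIdeal_bot : IsHomogeneousIdeal (⊥ : Ideal (CoordRing k)) := by
  intro f hf n
  rw [Ideal.mem_bot] at hf ⊢
  simp [hf]

theorem isHomogeneousIdeal_span_singleton {f : CoordRing k} {d : ℕ} (hf : f.IsHomogeneous d) :
    IsHomogeneousIdeal (Ideal.span {f}) := by
  intro g hg n
  obtain ⟨a, rfl⟩ := Ideal.mem_span_singleton'.1 hg
  rcases le_or_gt d n with h | h
  · obtain ⟨m, rfl⟩ := Nat.exists_eq_add_of_le' h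
    rw [homogeneousComponent_mul_add a hf]
    exact Ideal.mul_mem_left _ _ (Ideal.mem_span_singleton_self f)
  · rw [homogeneousComponent_mul_of_lt a hf h]
    exact zero_mem _

theorem IsHomogeneousIdeal.sup {I J : Ideal (CoordRing k)} (hI : IsHomogeneousIdeal I)
    (hJ : IsHomogeneousIdeal J) : IsHomogeneousIdeal (I ⊔ J) := by
  intro f hf n
  obtain ⟨a, ha, b, hb, rfl⟩ := Submodule.mem_sup.1 hf
  rw [map_add]
  exact add_mem (Ideal.mem_sup_left (hI a ha n)) (Ideal.mem_sup_right (hJ b hb n))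

theorem IsHomogeneousIdeal.sup_span {J : Ideal (CoordRing k)} (hJ : IsHomogeneousIdeal J)
    {f : CoordRing k} {d : ℕ} (hf : f.IsHomogeneous d) :
    IsHomogeneousIdeal (J ⊔ Ideal.span {f}) :=
  hJ.sup (isHomogeneousIdeal_span_singleton hf)

/-- The ideal quotient `J : f`. -/
def colonBy (J : Ideal (CoordRing k)) (f : CoordRing k) : Ideal (CoordRing k) where
  carrier := {a | f * a ∈ J}
  zero_mem' := by simp
  add_mem' := by
    intro a b ha hb
    simpa [mul_add] using add_mem (show f * a ∈ J from ha) hb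
  smul_mem' := by
    intro c a ha
    have := J.mul_mem_left c (show f * a ∈ J from ha)
    simpa [mul_left_comm] using this

theorem mem_colonBy {J : Ideal (CoordRing k)} {f a : CoordRing k} :
    a ∈ colonBy J f ↔ f * a ∈ J := Iff.rfl

theorem IsHomogeneousIdeal.colon {J : Ideal (CoordRing k)} (hJ : IsHomogeneousIdeal J)
    {f : CoordRing k} {d : ℕ} (hf : f.IsHomogeneous d) : IsHomogeneousIdeal (colonBy J f) := by
  intro a ha n
  rw [mem_colonBy] at ha ⊢
  have := hJ _ ha (n + d)
  rwa [mul_comm, homogeneousComponent_mul_add a hf, mul_comm] at this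

theorem le_colonBy (J : Ideal (CoordRing k)) (f : CoordRing k) : J ≤ colonBy J f :=
  fun _ ha => J.mul_mem_left f ha

theorem IsHomogeneousIdeal.le_of_forall {J : Ideal (CoordRing k)} (hJ : IsHomogeneousIdeal J)
    {K : Ideal (CoordRing k)} (h : ∀ n, ∀ f ∈ J, f.IsHomogeneous n → f ∈ K) : J ≤ K := by
  intro f hf
  rw [← sum_homogeneousComponent f]
  exact sum_mem fun i _ => h i _ (hJ f hf i) (homogeneousComponent_isHomogeneous i f)

/-- An element of degree `n + d` of `J + (f)` is the sum of an element of `J` and of a multiple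
of `f` by an element of degree `n`. -/
theorem exists_homogeneous_of_mem_sup_span {J : Ideal (CoordRing k)} (hJ : IsHomogeneousIdeal J)
    {f : CoordRing k} {d : ℕ} (hf : f.IsHomogeneous d) {g : CoordRing k} {n : ℕ}
    (hg : g.IsHomogeneous (n + d)) (h : g ∈ J ⊔ Ideal.span {f}) :
    ∃ a : CoordRing k, a.IsHomogeneous n ∧ g - a * f ∈ J := by
  obtain ⟨b, hb, c, hc, rfl⟩ := Submodule.mem_sup.1 h
  obtain ⟨a, rfl⟩ := Ideal.mem_span_singleton'.1 hc
  refine ⟨homogeneousComponent n a, homogeneousComponent_isHomogeneous n a, ?_⟩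
  have := hJ b hb (n + d)
  rwa [← homogeneousComponent_mul_add a hf, ← homogeneousComponent_self hg, map_add,
    add_sub_cancel_right]

/-- An element of degree less than `d` of `J + (f)` lies in `J`. -/
theorem mem_of_mem_sup_span_of_lt {J : Ideal (CoordRing k)} (hJ : IsHomogeneousIdeal J)
    {f : CoordRing k} {d : ℕ} (hf : f.IsHomogeneous d) {g : CoordRing k} {n : ℕ}
    (hg : g.IsHomogeneous n) (hn : n < d) (h : g ∈ J ⊔ Ideal.span {f}) : g ∈ J := by
  obtain ⟨b, hb, c, hc, rfl⟩ := Submodule.mem_sup.1 h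
  obtain ⟨a, rfl⟩ := Ideal.mem_span_singleton'.1 hc
  have := hJ b hb n
  rwa [← homogeneousComponent_self hg, map_add, homogeneousComponent_mul_of_lt a hf hn, add_zero]

/-! ### Hilbert functions and the residual exact sequence -/

instance finite_homogeneousSubmodule (n : ℕ) :
    Module.Finite k (homogeneousSubmodule (Fin 4) k n) :=
  Module.Finite.iff_fg.2 (homogeneousSubmodule_fg _ _ n)

/-- The graded piece `J ∩ P_n` inside `P_n`. -/
abbrev gradedPiece (J : Ideal (CoordRing k)) (n : ℕ) :
    Submodule k (homogeneousSubmodule (Fin 4) k n) :=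
  (J.restrictScalars k).comap (homogeneousSubmodule (Fin 4) k n).subtype

theorem hilbertFunction_eq (J : Ideal (CoordRing k)) (n : ℕ) :
    hilbertFunction J n = Module.finrank k (homogeneousSubmodule (Fin 4) k n ⧸ gradedPiece J n) :=
  rfl

theorem hilbertFunction_add (J : Ideal (CoordRing k)) (n : ℕ) :
    hilbertFunction J n + Module.finrank k (gradedPiece J n) =
      Module.finrank k (homogeneousSubmodule (Fin 4) k n) :=
  Submodule.finrank_quotient_add_finrank _

theorem gradedPiece_mono {J K : Ideal (CoordRing k)} (h : J ≤ K) (n : ℕ) :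
    gradedPiece J n ≤ gradedPiece K n := fun _ hx => h hx

theorem hilbertFunction_anti {J K : Ideal (CoordRing k)} (h : J ≤ K) (n : ℕ) :
    hilbertFunction K n ≤ hilbertFunction J n := by
  have h1 := hilbertFunction_add J n
  have h2 := hilbertFunction_add K n
  have := Submodule.finrank_mono (gradedPiece_mono h n)
  omega

theorem mem_of_hilbertFunction_le {J K : Ideal (CoordRing k)} (h : J ≤ K) {n : ℕ}
    (hn : hilbertFunction J n ≤ hilbertFunction K n) {f : CoordRing k} (hf : f.IsHomogeneous n)
    (hfK : f ∈ K) : f ∈ J := by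
  have h1 := hilbertFunction_add J n
  have h2 := hilbertFunction_add K n
  have h3 : gradedPiece J n = gradedPiece K n :=
    Submodule.eq_of_le_of_finrank_le (gradedPiece_mono h n) (by omega)
  have : (⟨f, hf⟩ : homogeneousSubmodule (Fin 4) k n) ∈ gradedPiece K n := hfK
  rw [← h3] at this
  exact this

theorem hilbertFunction_eq_zero {J : Ideal (CoordRing k)} {n : ℕ} :
    hilbertFunction J n = 0 ↔ ∀ f : CoordRing k, f.IsHomogeneous n → f ∈ J := by
  rw [hilbertFunction_eq, Module.finrank_eq_zero_iff_of_free, Submodule.Quotient.subsingleton_iff]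
  constructor
  · intro h f hf
    have : (⟨f, hf⟩ : homogeneousSubmodule (Fin 4) k n) ∈ gradedPiece J n := by rw [h]; trivial
    exact this
  · intro h
    rw [eq_top_iff]
    rintro ⟨f, hf⟩ -
    exact h f hf

theorem hilbertFunction_pos {J : Ideal (CoordRing k)} {n : ℕ} {f : CoordRing k}
    (hf : f.IsHomogeneous n) (h : f ∉ J) : 0 < hilbertFunction J n := by
  rw [Nat.pos_iff_ne_zero]
  exact fun h0 => h (hilbertFunction_eq_zero.1 h0 f hf)

/-- Multiplication by a form of degree `d`, as a map from degree `n` to degree `n + d`. -/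
def mulForm {f : CoordRing k} {d : ℕ} (hf : f.IsHomogeneous d) (n : ℕ) :
    homogeneousSubmodule (Fin 4) k n →ₗ[k] homogeneousSubmodule (Fin 4) k (n + d) :=
  ((LinearMap.mulRight k f).comp (homogeneousSubmodule (Fin 4) k n).subtype).codRestrict _
    fun a => IsHomogeneous.mul a.2 hf

/-- The exact sequence `0 → (P / (J : f))(-d) → P / J → P / (J + (f)) → 0`. -/
theorem hilbertFunction_sup_span {J K : Ideal (CoordRing k)} (hJ : IsHomogeneousIdeal J)
    {f : CoordRing k} {d : ℕ} (hf : f.IsHomogeneous d) (hK : ∀ a, a ∈ K ↔ f * a ∈ J) (n : ℕ) :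
    hilbertFunction J (n + d) =
      hilbertFunction (J ⊔ Ideal.span {f}) (n + d) + hilbertFunction K n := by
  set U := gradedPiece J (n + d)
  set V := gradedPiece (J ⊔ Ideal.span {f}) (n + d)
  have hUV : U ≤ V := gradedPiece_mono le_sup_left _
  set ψ := U.mkQ.comp (mulForm hf n)
  have hker : ψ.ker = gradedPiece K n := by
    ext a
    rw [LinearMap.mem_ker, LinearMap.comp_apply, Submodule.mkQ_apply,
      Submodule.Quotient.mk_eq_zero]
    change (a : CoordRing k) * f ∈ J ↔ (a : CoordRing k) ∈ K
    rw [hK, mul_comm]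
  have hrange : ψ.range = V.map U.mkQ := by
    ext y
    constructor
    · rintro ⟨a, rfl⟩
      refine ⟨mulForm hf n a, ?_, rfl⟩
      exact Ideal.mem_sup_right (Ideal.mul_mem_left _ _ (Ideal.mem_span_singleton_self f))
    · rintro ⟨⟨g, hg⟩, hgV, rfl⟩
      obtain ⟨a, ha, hag⟩ := exists_homogeneous_of_mem_sup_span hJ hf hg hgV
      refine ⟨⟨a, ha⟩, ?_⟩
      rw [LinearMap.comp_apply, Submodule.mkQ_apply, Submodule.mkQ_apply, eq_comm,
        Submodule.Quotient.eq]
      exact hag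
  have h1 : hilbertFunction K n = Module.finrank k ψ.range := by
    rw [hilbertFunction_eq, ← hker]
    exact ψ.quotKerEquivRange.finrank_eq
  have h2 := Submodule.finrank_quotient_add_finrank (V.map U.mkQ)
  rw [(Submodule.quotientQuotientEquivQuotient U V hUV).finrank_eq, ← hrange, ← h1] at h2
  exact h2.symm

/-- The case where `f` is a nonzerodivisor modulo `J`. -/
theorem hilbertFunction_sup_span_of_regular {J : Ideal (CoordRing k)} (hJ : IsHomogeneousIdeal J)
    {f : CoordRing k} {d : ℕ} (hf : f.IsHomogeneous d) (hreg : ∀ a, f * a ∈ J → a ∈ J) (n : ℕ) :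
    hilbertFunction J (n + d) =
      hilbertFunction (J ⊔ Ideal.span {f}) (n + d) + hilbertFunction J n :=
  hilbertFunction_sup_span hJ hf (fun a => ⟨J.mul_mem_left f, hreg a⟩) n

theorem hilbertFunction_sup_span_of_lt {J : Ideal (CoordRing k)} (hJ : IsHomogeneousIdeal J)
    {f : CoordRing k} {d : ℕ} (hf : f.IsHomogeneous d) {n : ℕ} (hn : n < d) :
    hilbertFunction (J ⊔ Ideal.span {f}) n = hilbertFunction J n := by
  apply le_antisymm (hilbertFunction_anti le_sup_left n)
  rw [hilbertFunction_eq, hilbertFunction_eq]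
  have : gradedPiece (J ⊔ Ideal.span {f}) n = gradedPiece J n :=
    le_antisymm (fun x hx => mem_of_mem_sup_span_of_lt hJ hf x.2 hn hx)
      (gradedPiece_mono le_sup_left n)
  rw [this]

/-! ### Independent linear forms: change of coordinates, primality, Hilbert functions -/

theorem finrank_homogeneousSubmodule_one :
    Module.finrank k (homogeneousSubmodule (Fin 4) k 1) = 4 := by
  rw [homogeneousSubmodule_one_eq_span_X, finrank_span_eq_card (linearIndependent_X (Fin 4) k),
    Fintype.card_fin]

/-- A linearly independent family in a subspace `W` of larger dimension can be extended by a
vector of `W`. -/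
theorem exists_linearIndependent_cons_mem (W : Submodule k (CoordRing k)) {n : ℕ}
    {v : Fin n → CoordRing k} (hv : LinearIndependent k v) (hW : ∀ i, v i ∈ W)
    (hn : n < Module.finrank k W) :
    ∃ x ∈ W, LinearIndependent k (Fin.cons x v : Fin (n + 1) → CoordRing k) := by
  have h1 : LinearIndependent k (fun i => (⟨v i, hW i⟩ : W)) :=
    LinearIndependent.of_comp W.subtype hv
  obtain ⟨x, hx⟩ := exists_linearIndependent_cons_of_lt_finrank h1 hn
  refine ⟨x, x.2, ?_⟩
  have h2 := hx.map' W.subtype W.ker_subtype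
  have h3 : W.subtype ∘ (Fin.cons x fun i => ⟨v i, hW i⟩ : Fin (n + 1) → W) =
      Fin.cons (x : CoordRing k) v := by
    ext i : 1
    refine Fin.cases ?_ (fun j => ?_) i <;> simp
  rwa [h3] at h2

theorem exists_extension_of_linearIndependent {r : ℕ} {v : Fin r → CoordRing k}
    (hv : LinearIndependent k v) (h1 : ∀ i, (v i).IsHomogeneous 1) :
    ∃ b : Fin 4 → CoordRing k, LinearIndependent k b ∧ (∀ i, (b i).IsHomogeneous 1) ∧
      ∃ ι : Fin r → Fin 4, Function.Injective ι ∧ v = b ∘ ι := by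
  have hr : r ≤ 4 := by
    have h : LinearIndependent k (fun i => (⟨v i, h1 i⟩ : homogeneousSubmodule (Fin 4) k 1)) :=
      LinearIndependent.of_comp (homogeneousSubmodule (Fin 4) k 1).subtype hv
    have h2 := h.fintype_card_le_finrank
    rwa [finrank_homogeneousSubmodule_one, Fintype.card_fin] at h2
  obtain ⟨m, hm⟩ := Nat.exists_eq_add_of_le hr
  induction m generalizing r with
  | zero =>
    obtain rfl : r = 4 := by omega
    exact ⟨v, hv, h1, id, Function.injective_id, rfl⟩
  | succ m ih =>
    obtain ⟨x, hx, hxv⟩ := exists_linearIndependent_cons_mem (homogeneousSubmodule (Fin 4) k 1)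
      hv h1 (by rw [finrank_homogeneousSubmodule_one]; omega)
    obtain ⟨b, hb, hb1, ι, hι, he⟩ := ih hxv
      (fun i => by refine Fin.cases ?_ (fun j => ?_) i <;>
        simp [h1, (mem_homogeneousSubmodule _ _).1 hx])
      (by omega) (by omega)
    refine ⟨b, hb, hb1, ι ∘ Fin.succ, hι.comp (Fin.succ_injective _), ?_⟩
    ext i : 1
    simpa using congrFun he i.succ

theorem X_mem_span_range {b : Fin 4 → CoordRing k} (hb : LinearIndependent k b)
    (hb1 : ∀ i, (b i).IsHomogeneous 1) (i : Fin 4) :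
    (X i : CoordRing k) ∈ Submodule.span k (Set.range b) := by
  have hspan : Submodule.span k (Set.range b) = homogeneousSubmodule (Fin 4) k 1 := by
    apply Submodule.eq_of_le_of_finrank_le
    · rw [Submodule.span_le]
      rintro _ ⟨i, rfl⟩
      exact hb1 i
    · rw [finrank_homogeneousSubmodule_one, finrank_span_eq_card hb, Fintype.card_fin]
  rw [hspan]
  exact isHomogeneous_X k i

/-- A basis of the space of linear forms gives an automorphism of the coordinate ring. -/
theorem exists_algEquiv_X {b : Fin 4 → CoordRing k} (hb : LinearIndependent k b)
    (hb1 : ∀ i, (b i).IsHomogeneous 1) :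
    ∃ e : CoordRing k ≃ₐ[k] CoordRing k, ∀ i, e (X i) = b i := by
  choose c hc using fun i => (Submodule.mem_span_range_iff_exists_fun k).1
    (X_mem_span_range hb hb1 i)
  set φ : CoordRing k →ₐ[k] CoordRing k := aeval b
  set ψ : CoordRing k →ₐ[k] CoordRing k := aeval fun i => ∑ j, c i j • (X j : CoordRing k)
  have hφψ : φ.comp ψ = AlgHom.id k _ := by
    apply MvPolynomial.algHom_ext
    intro i
    simp [φ, ψ, hc]
  have hψφ : ψ.comp φ = AlgHom.id k _ := by
    apply MvPolynomial.algHom_ext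
    intro i
    have h1 : b i ∈ Submodule.span k (Set.range (X : Fin 4 → CoordRing k)) := by
      rw [← homogeneousSubmodule_one_eq_span_X]
      exact hb1 i
    have h2 : Submodule.span k (Set.range (X : Fin 4 → CoordRing k)) ≤
        (Submodule.span k (Set.range (X : Fin 4 → CoordRing k))).comap ψ.toLinearMap := by
      rw [Submodule.span_le]
      rintro _ ⟨j, rfl⟩
      simp only [Submodule.comap_coe, Set.mem_preimage, SetLike.mem_coe, AlgHom.toLinearMap_apply,
        ψ, aeval_X]
      exact sum_mem fun l _ => Submodule.smul_mem _ _ (Submodule.subset_span ⟨l, rfl⟩)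
    -- The difference is a linear form in the variables, and `φ` turns it into a linear relation
    -- among the `b j`, so its coefficients vanish.
    have h3 : ψ (b i) - X i ∈ Submodule.span k (Set.range (X : Fin 4 → CoordRing k)) :=
      sub_mem (h2 h1) (Submodule.subset_span ⟨i, rfl⟩)
    obtain ⟨d, hd⟩ := (Submodule.mem_span_range_iff_exists_fun k).1 h3
    have h4 : ∑ j, d j • b j = 0 := by
      have h5 := congrArg φ hd
      have h6 : φ (ψ (b i)) = b i := DFunLike.congr_fun hφψ (b i)
      rw [map_sub, h6] at h5
      simpa [φ] using h5
    have h7 := Fintype.linearIndependent_iff.1 hb d h4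
    have h8 : ψ (b i) - X i = 0 := by rw [← hd]; simp [h7]
    simpa [φ] using sub_eq_zero.1 h8
  exact ⟨AlgEquiv.ofAlgHom φ ψ hφψ hψφ, fun i => aeval_X b i⟩

/-- In the coordinates `b`, setting the variables of `s` to zero changes a polynomial only by an
element of the ideal. This exhibits the ideal as the kernel of a map to a domain, which yields its
primality. -/
theorem mem_span_image_iff {b : Fin 4 → CoordRing k} (e : CoordRing k ≃ₐ[k] CoordRing k)
    (he : ∀ i, e (X i) = b i) (s : Set (Fin 4)) [DecidablePred (· ∈ s)] (f : CoordRing k) :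
    f ∈ Ideal.span (b '' s) ↔
      aeval (fun i => if i ∈ s then 0 else (X i : CoordRing k)) (e.symm f) = 0 := by
  set τ : CoordRing k →ₐ[k] CoordRing k := aeval (fun i => if i ∈ s then 0 else (X i : CoordRing k))
  have key : ∀ g : CoordRing k, e (g - τ g) ∈ Ideal.span (b '' s) := by
    have : (Ideal.Quotient.mkₐ k (Ideal.span (b '' s))).comp e.toAlgHom =
        (Ideal.Quotient.mkₐ k (Ideal.span (b '' s))).comp (e.toAlgHom.comp τ) := by
      apply MvPolynomial.algHom_ext
      intro i
      by_cases hi : i ∈ s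
      · simpa [τ, hi, he, Ideal.Quotient.eq_zero_iff_mem] using
          Ideal.subset_span (Set.mem_image_of_mem b hi)
      · simp [τ, hi]
    intro g
    rw [map_sub, ← Ideal.Quotient.eq]
    exact DFunLike.congr_fun this g
  constructor
  · intro hf
    have : Ideal.span (b '' s) ≤ RingHom.ker (τ.comp e.symm.toAlgHom) := by
      rw [Ideal.span_le]
      rintro _ ⟨i, hi, rfl⟩
      rw [← he]
      simp [τ, hi]
    exact this hf
  · intro hf
    simpa [hf] using key (e.symm f)

theorem isPrime_span_image {b : Fin 4 → CoordRing k} (hb : LinearIndependent k b)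
    (hb1 : ∀ i, (b i).IsHomogeneous 1) (s : Set (Fin 4)) : (Ideal.span (b '' s)).IsPrime := by
  classical
  obtain ⟨e, he⟩ := exists_algEquiv_X hb hb1
  have : Ideal.span (b '' s) = RingHom.ker ((aeval (fun i => if i ∈ s then 0 else
      (X i : CoordRing k)) : CoordRing k →ₐ[k] CoordRing k).comp e.symm.toAlgHom) := by
    ext f
    rw [mem_span_image_iff e he]
    rfl
  rw [this]
  exact RingHom.ker_isPrime _

theorem notMem_span_image {b : Fin 4 → CoordRing k} (hb : LinearIndependent k b)
    (hb1 : ∀ i, (b i).IsHomogeneous 1) {s : Set (Fin 4)} {j : Fin 4} (hj : j ∉ s) :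
    b j ∉ Ideal.span (b '' s) := by
  classical
  obtain ⟨e, he⟩ := exists_algEquiv_X hb hb1
  rw [mem_span_image_iff e he, ← he]
  simp [hj]

theorem isHomogeneousIdeal_span_image {b : Fin 4 → CoordRing k}
    (hb1 : ∀ i, (b i).IsHomogeneous 1) (s : Finset (Fin 4)) :
    IsHomogeneousIdeal (Ideal.span (b '' s)) := by
  induction s using Finset.induction_on with
  | empty => simpa using isHomogeneousIdeal_bot
  | insert a s _ ih =>
    rw [Finset.coe_insert, Set.image_insert_eq, Ideal.span_insert, sup_comm]
    exact ih.sup_span (hb1 a)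

/-- A further independent form is a nonzerodivisor modulo the prime spanned by the others, so the
values obey the Pascal recursion of `Nat.multichoose`. The induction is on the number `r` of forms
left out, starting from the irrelevant ideal, and then on the degree. -/
theorem hilbertFunction_span_image {b : Fin 4 → CoordRing k} (hb : LinearIndependent k b)
    (hb1 : ∀ i, (b i).IsHomogeneous 1) {r : ℕ} {s : Finset (Fin 4)} (hs : s.card + r = 4) (n : ℕ) :
    hilbertFunction (Ideal.span (b '' s)) n = Nat.multichoose r n := by
  have h0 : ∀ s : Finset (Fin 4), hilbertFunction (Ideal.span (b '' s)) 0 = 1 := by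
    intro s
    induction s using Finset.induction_on with
    | empty =>
      have hbot : gradedPiece (⊥ : Ideal (CoordRing k)) 0 = ⊥ := by
        rw [eq_bot_iff]
        exact fun x hx => Subtype.ext hx
      rw [Finset.coe_empty, Set.image_empty, Ideal.span_empty, hilbertFunction_eq, hbot,
        (Submodule.quotEquivOfEqBot ⊥ rfl).finrank_eq, homogeneousSubmodule_zero]
      have e := LinearEquiv.ofInjective (Algebra.linearMap k (CoordRing k))
        (FaithfulSMul.algebraMap_injective k (CoordRing k))
      rw [Submodule.one_eq_range, ← e.finrank_eq, Module.finrank_self]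
    | insert a s _ ih =>
      rw [Finset.coe_insert, Set.image_insert_eq, Ideal.span_insert, sup_comm,
        hilbertFunction_sup_span_of_lt (isHomogeneousIdeal_span_image hb1 s) (hb1 a) zero_lt_one,
        ih]
  induction r generalizing s n with
  | zero =>
    obtain rfl : s = Finset.univ := by
      rw [← Finset.card_eq_iff_eq_univ, Fintype.card_fin]; omega
    cases n with
    | zero => rw [h0, Nat.multichoose_zero_right]
    | succ n =>
      rw [Nat.multichoose_zero_succ, hilbertFunction_eq_zero]
      intro f hf
      have h1 : f ∈ Ideal.span ((X : Fin 4 → CoordRing k) '' Set.univ) := by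
        rw [mem_ideal_span_X_image]
        intro m hm
        by_contra! h
        have hm0 : m = 0 := by ext i; exact h i trivial
        have := hf (mem_support_iff.1 hm)
        rw [hm0] at this
        simp at this
      refine (Ideal.span_le.2 ?_ : Ideal.span ((X : Fin 4 → CoordRing k) '' Set.univ) ≤ _) h1
      rintro _ ⟨i, -, rfl⟩
      rw [Finset.coe_univ, Set.image_univ]
      exact Submodule.span_le_restrictScalars k (CoordRing k) _ (X_mem_span_range hb hb1 i)
  | succ r ih =>
    obtain ⟨a, ha⟩ : ∃ a, a ∉ s := by
      by_contra! h
      have : s = Finset.univ := Finset.eq_univ_of_forall h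
      rw [this, Finset.card_univ, Fintype.card_fin] at hs
      omega
    induction n with
    | zero => rw [h0, Nat.multichoose_zero_right]
    | succ n ihn =>
      have hp := isPrime_span_image hb hb1 (s : Set (Fin 4))
      rw [hilbertFunction_sup_span_of_regular (isHomogeneousIdeal_span_image hb1 s) (hb1 a)
        (fun c hc => (hp.mem_or_mem hc).resolve_left
          (notMem_span_image hb hb1 (by simpa using ha))) n,
        ihn, sup_comm, ← Ideal.span_insert, ← Set.image_insert_eq, ← Finset.coe_insert,
        ih (by rw [Finset.card_insert_of_notMem ha]; omega), Nat.multichoose_succ_succ]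

section LinearForms

variable {r : ℕ} {v : Fin r → CoordRing k}

theorem isPrime_span_range (hv : LinearIndependent k v) (h1 : ∀ i, (v i).IsHomogeneous 1) :
    (Ideal.span (Set.range v)).IsPrime := by
  obtain ⟨b, hb, hb1, ι, -, rfl⟩ := exists_extension_of_linearIndependent hv h1
  rw [Set.range_comp]
  exact isPrime_span_image hb hb1 _

theorem notMem_span_range_of_cons {x : CoordRing k}
    (hv : LinearIndependent k (Fin.cons x v : Fin (r + 1) → CoordRing k))
    (h1 : ∀ i, (v i).IsHomogeneous 1) (hx : x.IsHomogeneous 1) :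
    x ∉ Ideal.span (Set.range v) := by
  obtain ⟨b, hb, hb1, ι, hι, he⟩ := exists_extension_of_linearIndependent hv
    (fun i => by refine Fin.cases ?_ (fun j => ?_) i <;> simp [h1, hx])
  have hv' : v = b ∘ (ι ∘ Fin.succ) := by
    ext i : 1
    simpa using congrFun he i.succ
  have hx' : x = b (ι 0) := by simpa using congrFun he 0
  rw [hv', hx', Set.range_comp]
  refine notMem_span_image hb hb1 ?_
  rintro ⟨j, hj⟩
  exact Fin.succ_ne_zero j (hι hj)

theorem hilbertFunction_span_range (hv : LinearIndependent k v)
    (h1 : ∀ i, (v i).IsHomogeneous 1) {s : ℕ} (hs : r + s = 4) (n : ℕ) :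
    hilbertFunction (Ideal.span (Set.range v)) n = Nat.multichoose s n := by
  obtain ⟨b, hb, hb1, ι, hι, rfl⟩ := exists_extension_of_linearIndependent hv h1
  have : Set.range ι = (Finset.univ.image ι : Finset (Fin 4)) := by simp
  rw [Set.range_comp, this]
  refine hilbertFunction_span_image hb hb1 ?_ n
  rw [Finset.card_image_of_injective _ hι, Finset.card_univ, Fintype.card_fin, hs]

end LinearForms

theorem two_mul_multichoose_three (n : ℕ) :
    2 * Nat.multichoose 3 n = (n + 1) * (n + 2) := by
  induction n with
  | zero => simp
  | succ n ih =>
    rw [Nat.multichoose_succ_succ, Nat.multichoose_two, mul_add, ih]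
    ring

theorem six_mul_multichoose_four (n : ℕ) :
    6 * Nat.multichoose 4 n = (n + 1) * (n + 2) * (n + 3) := by
  induction n with
  | zero => simp
  | succ n ih =>
    have := two_mul_multichoose_three (n + 1)
    rw [Nat.multichoose_succ_succ, mul_add, ih]
    linarith

theorem hilbertFunction_bot (n : ℕ) :
    6 * hilbertFunction (⊥ : Ideal (CoordRing k)) n = (n + 1) * (n + 2) * (n + 3) := by
  rw [← six_mul_multichoose_four]
  congr 1
  have := hilbertFunction_span_range (v := (Fin.elim0 : Fin 0 → CoordRing k))
    linearIndependent_empty_type (fun i => i.elim0) (s := 4) rfl n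
  simpa using this

theorem linearIndependent_single {l : CoordRing k} (hl : l ≠ 0) : LinearIndependent k ![l] :=
  LinearIndependent.of_subsingleton 0 hl

theorem isPrime_span_linear {l : CoordRing k} (hl1 : l.IsHomogeneous 1) (hl : l ≠ 0) :
    (Ideal.span {l}).IsPrime := by
  simpa using isPrime_span_range (linearIndependent_single hl) (by simpa using hl1)

theorem hilbertFunction_span_linear {l : CoordRing k} (hl1 : l.IsHomogeneous 1) (hl : l ≠ 0)
    (n : ℕ) : 2 * hilbertFunction (Ideal.span {l}) n = (n + 1) * (n + 2) := by
  rw [← two_mul_multichoose_three]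
  congr 1
  simpa using hilbertFunction_span_range (linearIndependent_single hl) (by simpa using hl1)
    (s := 3) rfl n

theorem isPrime_span_pair {l₁ l₂ : CoordRing k} (h1 : l₁.IsHomogeneous 1) (h2 : l₂.IsHomogeneous 1)
    (h : LinearIndependent k ![l₁, l₂]) : (Ideal.span {l₁, l₂}).IsPrime := by
  have := isPrime_span_range h (by simp [Fin.forall_fin_two, h1, h2])
  rwa [Matrix.range_cons_cons_empty] at this

theorem hilbertFunction_span_pair {l₁ l₂ : CoordRing k} (h1 : l₁.IsHomogeneous 1)
    (h2 : l₂.IsHomogeneous 1) (h : LinearIndependent k ![l₁, l₂]) (n : ℕ) :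
    hilbertFunction (Ideal.span {l₁, l₂}) n = n + 1 := by
  have := hilbertFunction_span_range h (by simp [Fin.forall_fin_two, h1, h2]) (s := 2) rfl n
  rwa [Matrix.range_cons_cons_empty, Nat.multichoose_two] at this

theorem isHomogeneousIdeal_span_pair {d₁ d₂ : ℕ} {f g : CoordRing k} (hf : f.IsHomogeneous d₁)
    (hg : g.IsHomogeneous d₂) : IsHomogeneousIdeal (Ideal.span {f, g}) := by
  rw [Ideal.span_insert]
  exact (isHomogeneousIdeal_span_singleton hf).sup_span hg

/-- The Hilbert function of a plane curve of degree `d`. -/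
theorem hilbertFunction_planeCurve {l f : CoordRing k} (hl1 : l.IsHomogeneous 1) (hl : l ≠ 0)
    {d : ℕ} (hf : f.IsHomogeneous d) (hfl : f ∉ Ideal.span {l}) (n : ℕ) :
    2 * hilbertFunction (Ideal.span {l} ⊔ Ideal.span {f}) (n + d) + (n + 1) * (n + 2) =
      (n + d + 1) * (n + d + 2) := by
  have hp := isPrime_span_linear hl1 hl
  rw [← hilbertFunction_span_linear hl1 hl, ← hilbertFunction_span_linear hl1 hl,
    hilbertFunction_sup_span_of_regular (isHomogeneousIdeal_span_singleton hl1) hf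
      (fun a ha => (hp.mem_or_mem ha).resolve_left hfl)]
  ring

/-! ### Linear forms through a point -/

section Vanishing

/-- Vanishing at `a` is one linear condition on a space of dimension 4. Taking such forms at a point
where `f` does not vanish keeps `f` outside the ideal they generate; this is how regular sequences
are found below. -/
theorem exists_linearForm_vanishing (a : Fin 4 → k) {r : ℕ} {v : Fin r → CoordRing k}
    (hv : LinearIndependent k v) (h1 : ∀ i, (v i).IsHomogeneous 1) (ha : ∀ i, aeval a (v i) = 0)
    (hr : r < 3) : ∃ x : CoordRing k, x.IsHomogeneous 1 ∧ aeval a x = 0 ∧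
      LinearIndependent k (Fin.cons x v : Fin (r + 1) → CoordRing k) := by
  set ε : homogeneousSubmodule (Fin 4) k 1 →ₗ[k] k :=
    (aeval a : CoordRing k →ₐ[k] k).toLinearMap.comp (homogeneousSubmodule (Fin 4) k 1).subtype
  set W := ε.ker.map (homogeneousSubmodule (Fin 4) k 1).subtype
  have hW : ∀ x : CoordRing k, x ∈ W ↔ x.IsHomogeneous 1 ∧ aeval a x = 0 := by
    intro x
    constructor
    · rintro ⟨y, hy, rfl⟩
      exact ⟨y.2, hy⟩
    · rintro ⟨hx, hax⟩
      exact ⟨⟨x, hx⟩, hax, rfl⟩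
  have hrank : 3 ≤ Module.finrank k W := by
    have e1 : Module.finrank k W = Module.finrank k ε.ker :=
      Submodule.finrank_map_subtype_eq _ _
    have e2 := ε.finrank_range_add_finrank_ker
    have e3 := ε.range.finrank_le
    rw [finrank_homogeneousSubmodule_one] at e2
    rw [Module.finrank_self] at e3
    omega
  obtain ⟨x, hx, hxv⟩ := exists_linearIndependent_cons_mem W hv
    (fun i => (hW _).2 ⟨h1 i, ha i⟩) (hr.trans_le hrank)
  exact ⟨x, ((hW x).1 hx).1, ((hW x).1 hx).2, hxv⟩

theorem exists_point_of_notMem [IsAlgClosed k] {Q : Ideal (CoordRing k)} [Q.IsPrime]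
    {f : CoordRing k} (hf : f ∉ Q) :
    ∃ a : Fin 4 → k, (∀ p ∈ Q, aeval a p = 0) ∧ aeval a f ≠ 0 := by
  by_contra! h
  apply hf
  rw [← MvPolynomial.IsPrime.vanishingIdeal_zeroLocus (K := k) Q, mem_vanishingIdeal_iff]
  exact fun x hx => h x hx

theorem notMem_span_of_aeval {a : Fin 4 → k} {s : Set (CoordRing k)} (hs : ∀ p ∈ s, aeval a p = 0)
    {f : CoordRing k} (hf : aeval a f ≠ 0) : f ∉ Ideal.span s := by
  intro h
  have : Ideal.span s ≤ RingHom.ker (aeval a : CoordRing k →ₐ[k] k) :=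
    Ideal.span_le.2 hs
  exact hf (this h)

end Vanishing

/-! ### Saturation -/

theorem mem_irrelevantIdeal_pow {f : CoordRing k} {n N : ℕ} (hf : f.IsHomogeneous n)
    (h : N ≤ n) : f ∈ irrelevantIdeal k ^ N := by
  change f ∈ idealOfVars (Fin 4) k ^ N
  rw [mem_pow_idealOfVars_iff]
  intro x hx
  exact h.trans_eq (hf.degree_eq_sum_deg_support hx)

theorem pow_mem_irrelevantIdeal_pow {u : CoordRing k} (hu : u.IsHomogeneous 1) (N : ℕ) :
    u ^ N ∈ irrelevantIdeal k ^ N :=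
  mem_irrelevantIdeal_pow (by simpa using hu.pow N) le_rfl

theorem irrelevantIdeal_pow_le {N : ℕ} {J : Ideal (CoordRing k)}
    (h : ∀ g : CoordRing k, g.IsHomogeneous N → g ∈ J) : irrelevantIdeal k ^ N ≤ J := by
  change idealOfVars (Fin 4) k ^ N ≤ J
  rw [pow_idealOfVars_eq_span, Ideal.span_le]
  rintro _ ⟨d, hd, rfl⟩
  exact h _ (isHomogeneous_monomial _ hd)

/-- The saturation of `J`. -/
def saturation (J : Ideal (CoordRing k)) : Ideal (CoordRing k) where
  carrier := {f | ∃ N, ∀ g ∈ irrelevantIdeal k ^ N, g * f ∈ J}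
  zero_mem' := ⟨0, by simp⟩
  add_mem' := by
    rintro a b ⟨N, hN⟩ ⟨M, hM⟩
    refine ⟨max N M, fun g hg => ?_⟩
    rw [mul_add]
    exact add_mem (hN g (Ideal.pow_le_pow_right (le_max_left _ _) hg))
      (hM g (Ideal.pow_le_pow_right (le_max_right _ _) hg))
  smul_mem' := by
    rintro c a ⟨N, hN⟩
    refine ⟨N, fun g hg => ?_⟩
    rw [smul_eq_mul, mul_left_comm]
    exact J.mul_mem_left c (hN g hg)

theorem mem_saturation {J : Ideal (CoordRing k)} {f : CoordRing k} :
    f ∈ saturation J ↔ ∃ N, ∀ g ∈ irrelevantIdeal k ^ N, g * f ∈ J := Iff.rfl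

theorem le_saturation (J : Ideal (CoordRing k)) : J ≤ saturation J :=
  fun _ hf => ⟨0, fun g _ => J.mul_mem_left g hf⟩

/-- `A` is finitely generated, so the largest of the exponents of its generators serves for all
elements. -/
theorem exists_pow_mul_le_of_le_saturation {J A : Ideal (CoordRing k)} (hA : A ≤ saturation J) :
    ∃ N, ∀ f ∈ A, ∀ g ∈ irrelevantIdeal k ^ N, g * f ∈ J := by
  obtain ⟨s, hs⟩ := IsNoetherian.noetherian A
  choose! N hN using fun f (hf : f ∈ A) => mem_saturation.1 (hA hf)
  refine ⟨s.sup N, fun f hf g hg => ?_⟩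
  have hle : A ≤ colonBy J g := by
    rw [← hs, Submodule.span_le]
    intro x hx
    exact hN x (hs ▸ Submodule.subset_span hx) g
      (Ideal.pow_le_pow_right (Finset.le_sup (f := N) hx) hg)
  exact hle hf

theorem isSaturated_saturation (J : Ideal (CoordRing k)) : IsSaturated (saturation J) := by
  intro f N hN
  obtain ⟨M, hM⟩ := exists_pow_mul_le_of_le_saturation (J := J)
    (A := irrelevantIdeal k ^ N * Ideal.span {f}) (by
      rw [Ideal.mul_le]
      intro a ha b hb
      obtain ⟨c, rfl⟩ := Ideal.mem_span_singleton'.1 hb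
      rw [mul_left_comm]
      exact Ideal.mul_mem_left _ _ (hN a ha))
  refine ⟨M + N, fun g hg => ?_⟩
  rw [pow_add] at hg
  have : irrelevantIdeal k ^ M * irrelevantIdeal k ^ N ≤ colonBy J f := by
    rw [Ideal.mul_le]
    intro a ha b hb
    rw [mem_colonBy, mul_comm, mul_assoc]
    exact hM _ (Ideal.mul_mem_mul hb (Ideal.mem_span_singleton_self f)) a ha
  rw [mul_comm]
  exact this hg

theorem IsHomogeneousIdeal.saturation {J : Ideal (CoordRing k)} (hJ : IsHomogeneousIdeal J) :
    IsHomogeneousIdeal (saturation J) := by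
  rintro f ⟨N, hN⟩ n
  refine ⟨N, fun g hg => ?_⟩
  rw [mul_comm]
  refine irrelevantIdeal_pow_le (J := colonBy J (homogeneousComponent n f)) (fun h hh => ?_) hg
  rw [mem_colonBy, ← homogeneousComponent_mul_add f hh, mul_comm]
  exact hJ _ (hN h (mem_irrelevantIdeal_pow hh le_rfl)) _

/-- One power `M` of the irrelevant ideal carries the saturation into `J`. In degrees at least `M`
above all degrees of finitely many homogeneous generators, the coefficients lie in that power, so
the two ideals agree there. -/
theorem exists_hilbertFunction_saturation {J : Ideal (CoordRing k)} (hJ : IsHomogeneousIdeal J) :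
    ∃ N, ∀ n ≥ N, hilbertFunction (saturation J) n = hilbertFunction J n := by
  set T : Set (CoordRing k) := {f | f ∈ saturation J ∧ ∃ d, f.IsHomogeneous d}
  have hT : Ideal.span T = saturation J := by
    apply le_antisymm (Ideal.span_le.2 fun f hf => hf.1)
    exact hJ.saturation.le_of_forall fun n f hf hfn => Ideal.subset_span ⟨hf, n, hfn⟩
  obtain ⟨s, hsT, hs⟩ := (Submodule.fg_span_iff_fg_span_finset_subset T).1
    (IsNoetherian.noetherian (Ideal.span T))
  have hdeg : ∀ f ∈ s, ∃ d, f.IsHomogeneous d := fun f hf => (hsT hf).2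
  choose! D hD using hdeg
  obtain ⟨M, hM⟩ := exists_pow_mul_le_of_le_saturation (le_refl (saturation J))
  refine ⟨s.sup D + M, fun n hn => le_antisymm (hilbertFunction_anti (le_saturation J) n) ?_⟩
  have hle : gradedPiece (saturation J) n ≤ gradedPiece J n := by
    rintro ⟨f, hf⟩ hfS
    change f ∈ saturation J at hfS
    change f ∈ J
    rw [← hT] at hfS
    change f ∈ Submodule.span _ T at hfS
    rw [hs, Submodule.mem_span_finset] at hfS
    obtain ⟨c, -, rfl⟩ := hfS
    rw [← homogeneousComponent_self hf, map_sum]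
    refine sum_mem fun t ht => ?_
    have h1 : D t ≤ s.sup D := Finset.le_sup (f := D) ht
    obtain ⟨m, rfl⟩ := Nat.exists_eq_add_of_le' (show D t ≤ n by omega)
    rw [smul_eq_mul, homogeneousComponent_mul_add _ (hD t ht)]
    exact hM t (hsT ht).1 _ (mem_irrelevantIdeal_pow (homogeneousComponent_isHomogeneous _ _)
      (by omega))
  have h1 := hilbertFunction_add J n
  have h2 := hilbertFunction_add (saturation J) n
  have := Submodule.finrank_mono hle
  omega

/-- Modulo a saturated ideal some linear form is a nonzerodivisor. -/
theorem exists_regular_linearForm [Infinite k] {I : Ideal (CoordRing k)} (hI : IsSaturated I) :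
    ∃ u : CoordRing k, u.IsHomogeneous 1 ∧ ∀ a, u * a ∈ I → a ∈ I := by
  classical
  have hfin := associatedPrimes.finite (CoordRing k) (CoordRing k ⧸ I)
  set W : Ideal (CoordRing k) → Submodule k (homogeneousSubmodule (Fin 4) k 1) :=
    fun p => gradedPiece p 1
  -- An associated prime containing all linear forms would be the annihilator of a class killed by
  -- the irrelevant ideal, which is zero by saturation. Over an infinite field the finitely many
  -- proper subspaces `W p` then do not cover the linear forms.
  have htop : ⊤ ∉ hfin.toFinset.image W := by
    rw [Finset.mem_image]
    rintro ⟨p, hp, hpW⟩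
    rw [Set.Finite.mem_toFinset, AssociatedPrimes.mem_iff, isAssociatedPrime_iff] at hp
    obtain ⟨hprime, x, rfl⟩ := hp
    obtain ⟨f, rfl⟩ := Ideal.Quotient.mk_surjective x
    have hf : f ∈ I := by
      refine hI f 1 fun g hg => ?_
      rw [mul_comm]
      refine irrelevantIdeal_pow_le (J := colonBy I f) (fun h hh => ?_) hg
      have : (⟨h, hh⟩ : homogeneousSubmodule (Fin 4) k 1) ∈
          W (Submodule.colon ⊥ {Ideal.Quotient.mk I f}) := by rw [hpW]; trivial
      change h ∈ Submodule.colon ⊥ {Ideal.Quotient.mk I f} at this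
      rw [Submodule.mem_colon_singleton, Submodule.mem_bot] at this
      rw [mem_colonBy, mul_comm]
      exact Ideal.Quotient.eq_zero_iff_mem.1 this
    apply hprime.ne_top
    rw [Ideal.Quotient.eq_zero_iff_mem.2 hf]
    ext; simp
  have hne := Subspace.biUnion_ne_univ_of_top_notMem htop
  obtain ⟨u, hu⟩ := (Set.ne_univ_iff_exists_notMem _).1 hne
  refine ⟨u, u.2, fun a ha => ?_⟩
  by_contra haI
  have hmem : (u : CoordRing k) ∈ ⋃ p ∈ associatedPrimes (CoordRing k) (CoordRing k ⧸ I),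
      (p : Set (CoordRing k)) := by
    rw [biUnion_associatedPrimes_eq_zero_divisors]
    refine ⟨Ideal.Quotient.mk I a, fun h => haI (Ideal.Quotient.eq_zero_iff_mem.1 h), ?_⟩
    exact Ideal.Quotient.eq_zero_iff_mem.2 ha
  apply hu
  simp only [Set.mem_iUnion, exists_prop] at hmem ⊢
  obtain ⟨p, hp, hup⟩ := hmem
  exact ⟨W p, Finset.mem_image_of_mem W (hfin.mem_toFinset.2 hp), hup⟩

/-! ### Bounds on Hilbert functions from hyperplane sections -/

theorem hilbertFunction_eq_zero_of_le {J : Ideal (CoordRing k)} {m n : ℕ} (h : m ≤ n)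
    (hm : hilbertFunction J m = 0) : hilbertFunction J n = 0 :=
  hilbertFunction_eq_zero.2 fun _ hf =>
    irrelevantIdeal_pow_le (hilbertFunction_eq_zero.1 hm) (mem_irrelevantIdeal_pow hf h)

/-- The first difference is the Hilbert function of `S + (u)`, which stays zero once it is zero. So
the function increases strictly until it reaches its final value `c`. -/
theorem hilbertFunction_saturated_ge [Infinite k] {S : Ideal (CoordRing k)}
    (hS : IsHomogeneousIdeal S) (hsat : IsSaturated S) {c N : ℕ}
    (h : ∀ n ≥ N, hilbertFunction S n = c) (n : ℕ) : min (n + 1) c ≤ hilbertFunction S n := by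
  obtain ⟨u, hu1, hu⟩ := exists_regular_linearForm hsat
  have step := hilbertFunction_sup_span_of_regular hS hu1 hu
  induction n with
  | zero =>
    by_contra! h0
    have h1 : hilbertFunction S 0 = 0 := by omega
    have := hilbertFunction_eq_zero_of_le (Nat.zero_le N) h1
    have := h N le_rfl
    omega
  | succ n ih =>
    by_cases h0 : hilbertFunction (S ⊔ Ideal.span {u}) (n + 1) = 0
    · have hconst : ∀ j, hilbertFunction S (n + j) = hilbertFunction S n := by
        intro j
        induction j with
        | zero => rfl
        | succ j ihj =>
          have h1 := step (n + j)
          rw [hilbertFunction_eq_zero_of_le (by omega) h0] at h1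
          rw [← add_assoc]
          omega
      have h1 := hconst N
      have h2 := hconst 1
      have h3 := h (n + N) (by omega)
      omega
    · have := step n
      omega

theorem hilbertFunction_le_four_mul [Infinite k] {I : Ideal (CoordRing k)}
    (hI : IsHomogeneousIdeal I) (hsat : IsSaturated I) {N : ℕ}
    (h : ∀ n ≥ N, hilbertFunction I n = 4 * n) {n : ℕ} (hn : 2 ≤ n) :
    hilbertFunction I n ≤ 4 * n := by
  obtain ⟨u, hu1, hu⟩ := exists_regular_linearForm hsat
  have step := hilbertFunction_sup_span_of_regular hI hu1 hu
  set J := I ⊔ Ideal.span {u}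
  have hJ : IsHomogeneousIdeal J := hI.sup_span hu1
  obtain ⟨M, hM⟩ := exists_hilbertFunction_saturation hJ
  have h4 : ∀ m ≥ max (N + 1) M, hilbertFunction (saturation J) m = 4 := by
    intro m hm
    rw [hM m (by omega)]
    obtain ⟨m, rfl⟩ := Nat.exists_eq_add_of_le' (show 1 ≤ m by omega)
    have h1 := step m
    rw [h m (by omega), h (m + 1) (by omega)] at h1
    omega
  have hge := hilbertFunction_saturated_ge hJ.saturation (isSaturated_saturation J) h4
  -- As `n ≥ 2`, the increments are values of the section's Hilbert function in degrees at least 3,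
  -- where the lower bound is 4. An excess over `4 * n` would therefore persist in all larger
  -- degrees.
  have hgrow : ∀ j, 4 * j + hilbertFunction I n ≤ hilbertFunction I (n + j) := by
    intro j
    induction j with
    | zero => simp
    | succ j ih =>
      have h1 := step (n + j)
      have h2 := hge (n + j + 1)
      have h3 := hilbertFunction_anti (le_saturation J) (n + j + 1)
      rw [← add_assoc]
      omega
  have h1 := hgrow N
  have h2 := h (n + N) (by omega)
  omega

/-! ### Regular sequences and depth two -/

section Regular

variable {J Q : Ideal (CoordRing k)} {u v f : CoordRing k}

theorem regular_pow (hv : ∀ a, v * a ∈ J → a ∈ J) (N : ℕ) {a : CoordRing k} (h : v ^ N * a ∈ J) :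
    a ∈ J := by
  induction N with
  | zero => simpa using h
  | succ N ih =>
    rw [pow_succ', mul_assoc] at h
    exact ih (hv _ h)

/-- Write `a = j + b * u` with `j ∈ J`. Cancelling one factor `u` leaves the same assertion for `b`
with the exponent lowered by one. -/
theorem regular_sup_pow (hu : ∀ a, u * a ∈ J → a ∈ J)
    (hv : ∀ a, v * a ∈ J ⊔ Ideal.span {u} → a ∈ J ⊔ Ideal.span {u}) (N : ℕ) (a : CoordRing k)
    (h : v * a ∈ J ⊔ Ideal.span {u ^ N}) : a ∈ J ⊔ Ideal.span {u ^ N} := by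
  induction N generalizing a with
  | zero =>
    rw [pow_zero, Ideal.span_singleton_one, sup_top_eq]
    trivial
  | succ N ih =>
    have hle : J ⊔ Ideal.span {u ^ (N + 1)} ≤ J ⊔ Ideal.span {u} :=
      sup_le_sup_left (Ideal.span_singleton_le_span_singleton.2 (dvd_pow_self u N.succ_ne_zero)) J
    obtain ⟨j, hj, x, hx, rfl⟩ := Submodule.mem_sup.1 (hv a (hle h))
    obtain ⟨b, rfl⟩ := Ideal.mem_span_singleton'.1 hx
    obtain ⟨j', hj', y, hy, he⟩ := Submodule.mem_sup.1 h
    obtain ⟨c, rfl⟩ := Ideal.mem_span_singleton'.1 hy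
    have h1 : v * b - c * u ^ N ∈ J := by
      apply hu
      have : u * (v * b - c * u ^ N) = j' - v * j := by
        linear_combination -he
      rw [this]
      exact sub_mem hj' (J.mul_mem_left v hj)
    have h2 : v * b ∈ J ⊔ Ideal.span {u ^ N} := by
      rw [← sub_add_cancel (v * b) (c * u ^ N)]
      exact add_mem (Ideal.mem_sup_left h1)
        (Ideal.mem_sup_right (Ideal.mul_mem_left _ _ (Ideal.mem_span_singleton_self _)))
    obtain ⟨j'', hj'', z, hz, rfl⟩ := Submodule.mem_sup.1 (ih b h2)
    obtain ⟨d, rfl⟩ := Ideal.mem_span_singleton'.1 hz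
    refine add_mem (Ideal.mem_sup_left hj) ?_
    rw [add_mul]
    refine add_mem (Ideal.mem_sup_left (J.mul_mem_right _ hj'')) (Ideal.mem_sup_right ?_)
    rw [mul_assoc, ← pow_succ]
    exact Ideal.mul_mem_left _ _ (Ideal.mem_span_singleton_self _)

/-- If `u, v` is a regular sequence of linear forms modulo `J` and `f` is a nonzerodivisor modulo
`J`, then `J + (f)` is saturated. -/
theorem isSaturated_sup_span (hu1 : u.IsHomogeneous 1) (hv1 : v.IsHomogeneous 1)
    (hu : ∀ a, u * a ∈ J → a ∈ J)
    (hv : ∀ a, v * a ∈ J ⊔ Ideal.span {u} → a ∈ J ⊔ Ideal.span {u})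
    (hf : ∀ a, f * a ∈ J → a ∈ J) : IsSaturated (J ⊔ Ideal.span {f}) := by
  intro g N hN
  obtain ⟨j₁, hj₁, x₁, hx₁, h₁⟩ := Submodule.mem_sup.1 (hN _ (pow_mem_irrelevantIdeal_pow hu1 N))
  obtain ⟨j₂, hj₂, x₂, hx₂, h₂⟩ := Submodule.mem_sup.1 (hN _ (pow_mem_irrelevantIdeal_pow hv1 N))
  obtain ⟨w₁, rfl⟩ := Ideal.mem_span_singleton'.1 hx₁
  obtain ⟨w₂, rfl⟩ := Ideal.mem_span_singleton'.1 hx₂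
  -- The element `u ^ N * v ^ N * g` has been expressed in two ways modulo `J`; comparing the
  -- coefficients of `f` gives a relation from which `f` cancels.
  have h3 : v ^ N * w₁ - w₂ * u ^ N ∈ J := by
    apply hf
    have : f * (v ^ N * w₁ - w₂ * u ^ N) = u ^ N * j₂ - v ^ N * j₁ := by
      linear_combination v ^ N * h₁ - u ^ N * h₂
    rw [this]
    exact sub_mem (J.mul_mem_left _ hj₂) (J.mul_mem_left _ hj₁)
  have h4 : w₁ ∈ J ⊔ Ideal.span {u ^ N} := by
    refine regular_pow (regular_sup_pow hu hv N) N ?_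
    rw [← sub_add_cancel (v ^ N * w₁) (w₂ * u ^ N)]
    exact add_mem (Ideal.mem_sup_left h3)
      (Ideal.mem_sup_right (Ideal.mul_mem_left _ _ (Ideal.mem_span_singleton_self _)))
  obtain ⟨j₃, hj₃, x₃, hx₃, rfl⟩ := Submodule.mem_sup.1 h4
  obtain ⟨w, rfl⟩ := Ideal.mem_span_singleton'.1 hx₃
  have h5 : g - w * f ∈ J := by
    refine regular_pow hu N ?_
    have : u ^ N * (g - w * f) = j₁ + f * j₃ := by
      linear_combination -h₁
    rw [this]
    exact add_mem hj₁ (J.mul_mem_left _ hj₃)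
  rw [← sub_add_cancel g (w * f)]
  exact add_mem (Ideal.mem_sup_left h5)
    (Ideal.mem_sup_right (Ideal.mul_mem_left _ _ (Ideal.mem_span_singleton_self _)))

/-- This interchanges a regular sequence: `u`, `f` is regular modulo `Q`, and `u` stays a
nonzerodivisor after `f` has been added first. -/
theorem regular_sup_span (hQ : Q.IsPrime) (hu : u ∉ Q) (hQu : (Q ⊔ Ideal.span {u}).IsPrime)
    (hf : f ∉ Q ⊔ Ideal.span {u}) (a : CoordRing k) (h : u * a ∈ Q ⊔ Ideal.span {f}) :
    a ∈ Q ⊔ Ideal.span {f} := by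
  obtain ⟨b, hb, x, hx, he⟩ := Submodule.mem_sup.1 h
  obtain ⟨c, rfl⟩ := Ideal.mem_span_singleton'.1 hx
  have h1 : c * f ∈ Q ⊔ Ideal.span {u} := by
    rw [← add_sub_cancel_left b (c * f), he]
    exact sub_mem (Ideal.mem_sup_right (Ideal.mul_mem_right _ _ (Ideal.mem_span_singleton_self _)))
      (Ideal.mem_sup_left hb)
  obtain ⟨b', hb', y, hy, rfl⟩ := Submodule.mem_sup.1 ((hQu.mem_or_mem h1).resolve_right hf)
  obtain ⟨d, rfl⟩ := Ideal.mem_span_singleton'.1 hy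
  have h2 : u * (a - d * f) ∈ Q := by
    have : u * (a - d * f) = b + f * b' := by linear_combination -he
    rw [this]
    exact add_mem hb (Q.mul_mem_left _ hb')
  have h3 := (hQ.mem_or_mem h2).resolve_left hu
  rw [← sub_add_cancel a (d * f)]
  exact add_mem (Ideal.mem_sup_left h3)
    (Ideal.mem_sup_right (Ideal.mul_mem_left _ _ (Ideal.mem_span_singleton_self _)))

/-- No power of `v` lies in `(J : g) + (u)`, since it would bring `g` into `J + (u)`. As `u` is a
nonzerodivisor modulo `J : g`, the Hilbert function of `J : g` has positive first differences. -/
theorem le_hilbertFunction_colonBy_of_notMem (hJ : IsHomogeneousIdeal J)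
    (hu1 : u.IsHomogeneous 1) (hv1 : v.IsHomogeneous 1) (hu : ∀ a, u * a ∈ J → a ∈ J)
    (hv : ∀ a, v * a ∈ J ⊔ Ideal.span {u} → a ∈ J ⊔ Ideal.span {u}) {n : ℕ} {g : CoordRing k}
    (hg : g.IsHomogeneous n) (hgJ : g ∉ J ⊔ Ideal.span {u}) (m : ℕ) :
    m + 1 ≤ hilbertFunction (colonBy J g) m := by
  have hpos : ∀ N, v ^ N ∉ colonBy J g ⊔ Ideal.span {u} := by
    intro N h
    apply hgJ
    apply regular_pow hv N
    obtain ⟨c, hc, x, hx, he⟩ := Submodule.mem_sup.1 h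
    rw [← he, add_mul]
    refine add_mem (Ideal.mem_sup_left ?_)
      (Ideal.mul_mem_right _ _ (Ideal.mem_sup_right hx))
    rw [mul_comm]
    exact hc
  have hvh : ∀ N, (v ^ N).IsHomogeneous N := fun N => by simpa using hv1.pow N
  induction m with
  | zero => exact hilbertFunction_pos (hvh 0) fun h => hpos 0 (Ideal.mem_sup_left h)
  | succ m ih =>
    have h1 := hilbertFunction_sup_span_of_regular (hJ.colon hg) hu1
      (fun a ha => hu _ (by rw [mul_left_comm]; exact ha)) m
    have h2 := hilbertFunction_pos (hvh (m + 1)) (hpos (m + 1))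
    omega

/-- If `P / J` has depth at least two, the ideal quotients of `J` by forms have dimension two. -/
theorem le_hilbertFunction_colonBy (hJ : IsHomogeneousIdeal J) (hu1 : u.IsHomogeneous 1)
    (hv1 : v.IsHomogeneous 1) (hu : ∀ a, u * a ∈ J → a ∈ J)
    (hv : ∀ a, v * a ∈ J ⊔ Ideal.span {u} → a ∈ J ⊔ Ideal.span {u}) {n : ℕ} {g : CoordRing k}
    (hg : g.IsHomogeneous n) (hgJ : g ∉ J) (m : ℕ) : m + 1 ≤ hilbertFunction (colonBy J g) m := by
  induction n generalizing g with
  | zero =>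
    exact le_hilbertFunction_colonBy_of_notMem hJ hu1 hv1 hu hv hg
      (fun h => hgJ (mem_of_mem_sup_span_of_lt hJ hu1 hg zero_lt_one h)) m
  | succ n ih =>
    by_cases hgu : g ∈ J ⊔ Ideal.span {u}
    · obtain ⟨g', hg', hgg⟩ := exists_homogeneous_of_mem_sup_span hJ hu1 hg hgu
      -- Modulo `J`, `g` is `g' * u` and `u` can be cancelled, so `g` and `g'` have the same ideal
      -- quotient while the degree drops.
      have hiff : ∀ a, g * a ∈ J ↔ g' * a ∈ J := by
        intro a
        have h1 : (g - g' * u) * a ∈ J := J.mul_mem_right a hgg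
        have h2 : g * a = (g - g' * u) * a + u * (g' * a) := by ring
        rw [h2, J.add_mem_iff_right h1]
        exact ⟨hu _, J.mul_mem_left u⟩
      have hcolon : colonBy J g = colonBy J g' := by
        ext a
        exact hiff a
      rw [hcolon]
      refine ih hg' fun h => hgJ ?_
      simpa using (hiff 1).2 (by simpa using h)
    · exact le_hilbertFunction_colonBy_of_notMem hJ hu1 hv1 hu hv hg hgu m

end Regular

theorem IsHomogeneousIdeal.hilbertFunction_sup_span_le {J : Ideal (CoordRing k)}
    (hJ : IsHomogeneousIdeal J) {g : CoordRing k} {e : ℕ} (hg : g.IsHomogeneous e) {c n : ℕ}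
    (h : c ≤ hilbertFunction (colonBy J g) n) :
    hilbertFunction (J ⊔ Ideal.span {g}) (n + e) + c ≤ hilbertFunction J (n + e) := by
  rw [hilbertFunction_sup_span hJ hg (K := colonBy J g) (fun _ => Iff.rfl) n]
  omega

/-! ### Plane curves, complete intersections, finite subschemes of a line -/

section Forms

variable {l f g u v : CoordRing k}

theorem span_pair_eq_sup (a b : CoordRing k) :
    Ideal.span {a, b} = Ideal.span {b} ⊔ Ideal.span {a} := by
  rw [Ideal.span_insert, sup_comm]

theorem span_triple_eq_sup (a b c : CoordRing k) :
    Ideal.span {a, b, c} = Ideal.span {a, b} ⊔ Ideal.span {c} := by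
  rw [Ideal.span_insert, Ideal.span_insert, Ideal.span_insert, sup_assoc]

/-- Linear forms `v, u, l` that are linearly independent span a chain of primes. -/
theorem isPrime_span_triple (hl1 : l.IsHomogeneous 1) (hu1 : u.IsHomogeneous 1)
    (hv1 : v.IsHomogeneous 1) (h : LinearIndependent k ![v, u, l]) :
    (Ideal.span {l} ⊔ Ideal.span {u} ⊔ Ideal.span {v}).IsPrime := by
  have := isPrime_span_range h (by simp [Fin.forall_fin_succ, hl1, hu1, hv1])
  have e : Set.range ![v, u, l] = {v, u, l} := by
    rw [Matrix.range_cons, Matrix.range_cons_cons_empty, Set.singleton_union]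
  rwa [e, Ideal.span_insert, span_pair_eq_sup, sup_comm] at this

theorem notMem_span_single (hl1 : l.IsHomogeneous 1) (hu1 : u.IsHomogeneous 1)
    (h : LinearIndependent k ![u, l]) : u ∉ Ideal.span {l} := by
  have := notMem_span_range_of_cons (v := ![l]) h (by simpa using hl1) hu1
  simpa using this

theorem notMem_span_double (hl1 : l.IsHomogeneous 1) (hu1 : u.IsHomogeneous 1)
    (hv1 : v.IsHomogeneous 1) (h : LinearIndependent k ![v, u, l]) :
    v ∉ Ideal.span {l} ⊔ Ideal.span {u} := by
  have := notMem_span_range_of_cons (v := ![u, l]) h (by simp [Fin.forall_fin_two, hl1, hu1]) hv1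
  rwa [Matrix.range_cons_cons_empty, span_pair_eq_sup] at this

/-- A curve in a plane has depth two: its ideal plus one more form drops the Hilbert polynomial
by at least a linear function. -/
theorem hilbertFunction_planeCurve_sup_span [IsAlgClosed k] (hl1 : l.IsHomogeneous 1)
    (hl : l ≠ 0) {d : ℕ} (hf : f.IsHomogeneous d) (hfl : f ∉ Ideal.span {l}) {e : ℕ}
    (hg : g.IsHomogeneous e) (hgJ : g ∉ Ideal.span {l} ⊔ Ideal.span {f}) (n : ℕ) :
    hilbertFunction (Ideal.span {l} ⊔ Ideal.span {f} ⊔ Ideal.span {g}) (n + e) + (n + 1) ≤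
      hilbertFunction (Ideal.span {l} ⊔ Ideal.span {f}) (n + e) := by
  have hp := isPrime_span_linear hl1 hl
  -- A point of the plane off the curve. The linear forms `u`, `v` through it satisfy `f ∉ (l, u,
  -- v)`, so they form a regular sequence modulo `(l, f)`.
  obtain ⟨a, ha, haf⟩ := exists_point_of_notMem hfl
  have hal := ha l (Ideal.mem_span_singleton_self l)
  obtain ⟨u, hu1, hau, hul⟩ := exists_linearForm_vanishing a (linearIndependent_single hl)
    (by simpa using hl1) (by simpa using hal) (by norm_num)
  obtain ⟨v, hv1, hav, hvul⟩ := exists_linearForm_vanishing a (v := ![u, l]) hul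
    (by simp [Fin.forall_fin_two, hl1, hu1]) (by simpa [Fin.forall_fin_two] using ⟨hau, hal⟩)
    (by norm_num)
  have hlu : (Ideal.span {l} ⊔ Ideal.span {u}).IsPrime := by
    rw [← span_pair_eq_sup]
    exact isPrime_span_pair hu1 hl1 hul
  have hfluv : f ∉ Ideal.span {l} ⊔ Ideal.span {u} ⊔ Ideal.span {v} := by
    rw [← span_pair_eq_sup, sup_comm, ← Ideal.span_insert]
    exact notMem_span_of_aeval (by simpa using ⟨hav, hau, hal⟩) haf
  have hJ := (isHomogeneousIdeal_span_singleton hl1).sup_span hf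
  refine hJ.hilbertFunction_sup_span_le hg
    (le_hilbertFunction_colonBy hJ hu1 hv1 ?_ ?_ hg hgJ n)
  · exact regular_sup_span hp (notMem_span_single hl1 hu1 hul) hlu
      fun h => hfluv (Ideal.mem_sup_left h)
  · rw [sup_right_comm]
    exact regular_sup_span hlu (notMem_span_double hl1 hu1 hv1 hvul)
      (isPrime_span_triple hl1 hu1 hv1 hvul) hfluv

/-- A complete intersection of two forms is saturated. -/
theorem isSaturated_span_pair [IsAlgClosed k] (hf0 : f ≠ 0)
    (hg : ∀ a, g * a ∈ Ideal.span {f} → a ∈ Ideal.span {f}) :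
    IsSaturated (Ideal.span {f} ⊔ Ideal.span {g}) := by
  obtain ⟨a, -, haf⟩ := exists_point_of_notMem (Q := (⊥ : Ideal (CoordRing k))) (f := f)
    (by simpa using hf0)
  obtain ⟨u, hu1, hau, hu⟩ := exists_linearForm_vanishing a (v := ![])
    linearIndependent_empty_type (fun i => i.elim0) (fun i => i.elim0) (by norm_num)
  have hu0 : u ≠ 0 := hu.ne_zero 0
  obtain ⟨v, hv1, hav, hvu⟩ := exists_linearForm_vanishing a (v := ![u]) hu
    (by simpa using hu1) (by simpa using hau) (by norm_num)
  have hp := isPrime_span_linear hu1 hu0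
  have huv : (Ideal.span {u} ⊔ Ideal.span {v}).IsPrime := by
    rw [← span_pair_eq_sup]
    exact isPrime_span_pair hv1 hu1 hvu
  have hfuv : f ∉ Ideal.span {u} ⊔ Ideal.span {v} := by
    rw [← span_pair_eq_sup]
    exact notMem_span_of_aeval (by simpa using ⟨hav, hau⟩) haf
  refine isSaturated_sup_span hu1 hv1 ?_ ?_ hg
  · have := regular_sup_span (Q := ⊥) (u := u) (f := f) Ideal.isPrime_bot (by simpa using hu0)
      (by simpa using hp) (by simpa using fun h => hfuv (Ideal.mem_sup_left h))
    simpa using this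
  · rw [sup_comm (Ideal.span {f})]
    exact regular_sup_span hp (notMem_span_single hu1 hv1 hvu) huv hfuv

theorem isSaturated_planeCurve [IsAlgClosed k] (hl1 : l.IsHomogeneous 1) (hl : l ≠ 0)
    (hfl : f ∉ Ideal.span {l}) : IsSaturated (Ideal.span {l} ⊔ Ideal.span {f}) :=
  isSaturated_span_pair hl fun _ ha =>
    ((isPrime_span_linear hl1 hl).mem_or_mem ha).resolve_left hfl

/-- A finite subscheme of a line is defined by a saturated ideal. -/
theorem isSaturated_span_triple {l₁ l₂ q : CoordRing k} (h1 : l₁.IsHomogeneous 1)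
    (h2 : l₂.IsHomogeneous 1) (h : LinearIndependent k ![l₁, l₂]) (hq : q ∉ Ideal.span {l₁, l₂}) :
    IsSaturated (Ideal.span {l₁, l₂, q}) := by
  have hp := isPrime_span_pair h1 h2 h
  obtain ⟨u, hu1, hu⟩ := exists_linearIndependent_cons_mem (homogeneousSubmodule (Fin 4) k 1) h
    (by simp [Fin.forall_fin_two, h1, h2]) (by rw [finrank_homogeneousSubmodule_one]; norm_num)
  obtain ⟨v, hv1, hv⟩ := exists_linearIndependent_cons_mem (homogeneousSubmodule (Fin 4) k 1) hu
    (by simpa [Fin.forall_fin_succ, h1, h2] using hu1)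
    (by rw [finrank_homogeneousSubmodule_one]; norm_num)
  rw [mem_homogeneousSubmodule] at hu1 hv1
  have hrange : Set.range (Fin.cons u ![l₁, l₂] : Fin 3 → CoordRing k) = {u, l₁, l₂} := by
    rw [Fin.range_cons, Matrix.range_cons_cons_empty]
  have hh1 : ∀ i, ((Fin.cons u ![l₁, l₂] : Fin 3 → CoordRing k) i).IsHomogeneous 1 := by
    simp [Fin.forall_fin_succ, h1, h2, hu1]
  have hpu : (Ideal.span {l₁, l₂} ⊔ Ideal.span {u}).IsPrime := by
    have := isPrime_span_range hu hh1
    rwa [hrange, Ideal.span_insert, sup_comm] at this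
  have hunot : u ∉ Ideal.span {l₁, l₂} := by
    have := notMem_span_range_of_cons hu (by simp [Fin.forall_fin_two, h1, h2]) hu1
    rwa [Matrix.range_cons_cons_empty] at this
  have hvnot : v ∉ Ideal.span {l₁, l₂} ⊔ Ideal.span {u} := by
    have := notMem_span_range_of_cons hv hh1 hv1
    rwa [hrange, Ideal.span_insert, sup_comm] at this
  rw [span_triple_eq_sup]
  exact isSaturated_sup_span hu1 hv1 (fun a ha => (hp.mem_or_mem ha).resolve_left hunot)
    (fun a ha => (hpu.mem_or_mem ha).resolve_left hvnot)
    (fun a ha => (hp.mem_or_mem ha).resolve_left hq)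

/-- The Hilbert function of a finite subscheme of length `d` of a line. -/
theorem hilbertFunction_span_triple {l₁ l₂ q : CoordRing k} (h1 : l₁.IsHomogeneous 1)
    (h2 : l₂.IsHomogeneous 1) (h : LinearIndependent k ![l₁, l₂]) {d : ℕ} (hq : q.IsHomogeneous d)
    (hq' : q ∉ Ideal.span {l₁, l₂}) (n : ℕ) :
    hilbertFunction (Ideal.span {l₁, l₂, q}) (n + d) = d := by
  have hp := isPrime_span_pair h1 h2 h
  have := hilbertFunction_sup_span_of_regular (isHomogeneousIdeal_span_pair h1 h2) hq
    (fun a ha => (hp.mem_or_mem ha).resolve_left hq') n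
  rw [hilbertFunction_span_pair h1 h2 h, hilbertFunction_span_pair h1 h2 h,
    ← span_triple_eq_sup] at this
  omega

end Forms

/-! ### Explicit resolutions and upper bounds for the regularity -/

/-- A graded free resolution `0 → F₂ → F₁ → F₀ → I → 0` of length two. -/
def resolutionOfLengthTwo {I : Ideal (CoordRing k)} {r₀ r₁ r₂ : ℕ} (d₀ : Fin r₀ → ℕ)
    (d₁ : Fin r₁ → ℕ) (d₂ : Fin r₂ → ℕ) (aug : Fin r₀ → CoordRing k)
    (A : Matrix (Fin r₀) (Fin r₁) (CoordRing k)) (B : Matrix (Fin r₁) (Fin r₂) (CoordRing k))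
    (haug : ∀ r, (aug r).IsHomogeneous (d₀ r))
    (hA : ∀ r s, A r s ≠ 0 → ∃ e : ℕ, (A r s).IsHomogeneous e ∧ e + d₀ r = d₁ s)
    (hB : ∀ r s, B r s ≠ 0 → ∃ e : ℕ, (B r s).IsHomogeneous e ∧ e + d₁ r = d₂ s)
    (hI : Ideal.span (Set.range aug) = I)
    (h₀ : ∀ v, aug ⬝ᵥ v = 0 ↔ ∃ w, A *ᵥ w = v)
    (h₁ : ∀ v, A *ᵥ v = 0 ↔ ∃ w, B *ᵥ w = v)
    (h₂ : ∀ v, B *ᵥ v = 0 → v = 0) : GradedFreeResolution I where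
  rank
    | 0 => r₀
    | 1 => r₁
    | 2 => r₂
    | _ + 3 => 0
  deg
    | 0 => d₀
    | 1 => d₁
    | 2 => d₂
    | _ + 3 => Fin.elim0
  aug := aug
  mat
    | 0 => A
    | 1 => B
    | _ + 2 => 0
  aug_homogeneous := haug
  mat_homogeneous
    | 0 => hA
    | 1 => hB
    | _ + 2 => fun _ s => s.elim0
  span_aug := hI
  exact_zero := h₀
  exact_succ
    | 0 => h₁
    | 1 => fun v => ⟨fun h => ⟨0, by rw [h₂ v h, Matrix.mulVec_zero]⟩, by
        rintro ⟨w, rfl⟩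
        rw [Matrix.zero_mulVec, Matrix.mulVec_zero]⟩
    | _ + 2 => fun v => ⟨fun _ => ⟨0, funext fun i => i.elim0⟩, fun _ => Matrix.zero_mulVec v⟩

theorem isRegular_of_resolutionOfLengthTwo {I : Ideal (CoordRing k)} {r₀ r₁ r₂ : ℕ}
    (d₀ : Fin r₀ → ℕ) (d₁ : Fin r₁ → ℕ) (d₂ : Fin r₂ → ℕ) (aug : Fin r₀ → CoordRing k)
    (A : Matrix (Fin r₀) (Fin r₁) (CoordRing k)) (B : Matrix (Fin r₁) (Fin r₂) (CoordRing k))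
    (haug : ∀ r, (aug r).IsHomogeneous (d₀ r))
    (hA : ∀ r s, A r s ≠ 0 → ∃ e : ℕ, (A r s).IsHomogeneous e ∧ e + d₀ r = d₁ s)
    (hB : ∀ r s, B r s ≠ 0 → ∃ e : ℕ, (B r s).IsHomogeneous e ∧ e + d₁ r = d₂ s)
    (hI : Ideal.span (Set.range aug) = I)
    (h₀ : ∀ v, aug ⬝ᵥ v = 0 ↔ ∃ w, A *ᵥ w = v)
    (h₁ : ∀ v, A *ᵥ v = 0 ↔ ∃ w, B *ᵥ w = v)
    (h₂ : ∀ v, B *ᵥ v = 0 → v = 0) {m : ℕ} (hd₀ : ∀ i, d₀ i ≤ m) (hd₁ : ∀ i, d₁ i ≤ m + 1)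
    (hd₂ : ∀ i, d₂ i ≤ m + 2) : IsRegular I m := by
  refine ⟨resolutionOfLengthTwo d₀ d₁ d₂ aug A B haug hA hB hI h₀ h₁ h₂, fun i j => ?_⟩
  match i, j with
  | 0, j => exact_mod_cast hd₀ j
  | 1, j => exact_mod_cast hd₁ j
  | 2, j => exact_mod_cast hd₂ j
  | _ + 3, j => exact j.elim0

/-- The Koszul relation generates the syzygies of a regular sequence; all exactness checks below
reduce to this. -/
theorem exists_of_syzygy {f g x y : CoordRing k} (hf : f ≠ 0)
    (hg : ∀ a, g * a ∈ Ideal.span {f} → a ∈ Ideal.span {f}) (h : f * x + g * y = 0) :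
    ∃ m, x = g * m ∧ y = -(f * m) := by
  have h1 : g * y ∈ Ideal.span {f} := by
    rw [Ideal.mem_span_singleton]
    exact ⟨-x, by linear_combination h⟩
  obtain ⟨m, rfl⟩ := Ideal.mem_span_singleton.1 (hg y h1)
  refine ⟨-m, ?_, by ring⟩
  apply mul_left_cancel₀ hf
  linear_combination h

theorem span_linear_regular {l₁ l₂ : CoordRing k} (h1 : l₁.IsHomogeneous 1)
    (h2 : l₂.IsHomogeneous 1) (h : LinearIndependent k ![l₁, l₂]) (a : CoordRing k)
    (ha : l₂ * a ∈ Ideal.span {l₁}) : a ∈ Ideal.span {l₁} := by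
  have h' : LinearIndependent k ![l₂, l₁] := by
    rw [LinearIndependent.pair_symm_iff]
    exact h
  exact ((isPrime_span_linear h1 (h.ne_zero 0)).mem_or_mem ha).resolve_left
    (notMem_span_single h1 h2 h')

theorem isRegular_three_of_completeIntersection {q₁ q₂ : CoordRing k} (h1 : q₁.IsHomogeneous 2)
    (h2 : q₂.IsHomogeneous 2) (h0 : q₁ ≠ 0)
    (h : ∀ a, q₂ * a ∈ Ideal.span {q₁} → a ∈ Ideal.span {q₁}) :
    IsRegular (Ideal.span {q₁, q₂}) 3 := by
  refine isRegular_of_resolutionOfLengthTwo (m := 3) ![2, 2] ![4] ![] ![q₁, q₂] !![q₂; -q₁]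
    (0 : Matrix (Fin 1) (Fin 0) (CoordRing k)) ?_ ?_ ?_ ?_ ?_ ?_ ?_ ?_ ?_ ?_
  · simp [Fin.forall_fin_two, h1, h2]
  · simp only [Fin.forall_fin_two, Fin.forall_fin_one]
    exact ⟨fun _ => ⟨2, h2, rfl⟩, fun _ => ⟨2, h1.neg, rfl⟩⟩
  · exact fun _ s => s.elim0
  · rw [Matrix.range_cons_cons_empty]
  · intro v
    constructor
    · intro hv
      simp only [dotProduct, Fin.sum_univ_two, Matrix.cons_val_zero, Matrix.cons_val_one] at hv
      obtain ⟨m, hm0, hm1⟩ := exists_of_syzygy h0 h hv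
      refine ⟨![m], ?_⟩
      ext i : 1
      fin_cases i <;> simp [Matrix.mulVec, dotProduct, hm0, hm1]
    · rintro ⟨w, rfl⟩
      simp [Matrix.mulVec, dotProduct, Fin.sum_univ_two]
      ring
  · intro v
    constructor
    · intro hv
      refine ⟨0, ?_⟩
      have h3 := congrFun hv 1
      simp [Matrix.mulVec, dotProduct, h0] at h3
      ext i : 1
      fin_cases i
      simp [h3]
    · rintro ⟨w, rfl⟩
      simp
  · exact fun v _ => funext fun i => i.elim0
  · simp [Fin.forall_fin_two]
  · simp
  · exact fun i => i.elim0

/-- With `c = a₁ * l₁ + a₂ * l₂`, the generators are, up to sign, the maximal minors of the relation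
matrix: a Hilbert–Burch resolution. -/
theorem isRegular_three_of_cubic {l l₁ l₂ c : CoordRing k} (hl1 : l.IsHomogeneous 1) (hl : l ≠ 0)
    (h1 : l₁.IsHomogeneous 1) (h2 : l₂.IsHomogeneous 1) (h : LinearIndependent k ![l₁, l₂])
    (hc3 : c.IsHomogeneous 3) (hc : c ∈ Ideal.span {l₁, l₂}) (hcl : c ∉ Ideal.span {l}) :
    IsRegular (Ideal.span {l * l₁, l * l₂, c}) 3 := by
  have hp := isPrime_span_linear hl1 hl
  have h10 : l₁ ≠ 0 := h.ne_zero 0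
  have h20 : l₂ ≠ 0 := h.ne_zero 1
  rw [span_pair_eq_sup] at hc
  obtain ⟨a₁, ha₁, hc'⟩ := exists_homogeneous_of_mem_sup_span (n := 2)
    (isHomogeneousIdeal_span_singleton h2) h1 hc3 hc
  have hh : (c - a₁ * l₁).IsHomogeneous (2 + 1) := hc3.sub (ha₁.mul h1)
  obtain ⟨a₂, ha₂, hc''⟩ := exists_homogeneous_of_mem_sup_span isHomogeneousIdeal_bot h2 hh
    (by simpa using hc')
  rw [Ideal.mem_bot] at hc''
  have hce : c = a₁ * l₁ + a₂ * l₂ := by linear_combination hc''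
  refine isRegular_of_resolutionOfLengthTwo (m := 3) ![2, 2, 3] ![3, 4] ![]
    ![l * l₁, l * l₂, c] !![l₂, a₁; -l₁, a₂; 0, -l]
    (0 : Matrix (Fin 2) (Fin 0) (CoordRing k)) ?_ ?_ ?_ ?_ ?_ ?_ ?_ ?_ ?_ ?_
  · simp only [Fin.forall_fin_succ]
    exact ⟨hl1.mul h1, hl1.mul h2, hc3, fun i => i.elim0⟩
  · simp only [Fin.forall_fin_succ]
    exact ⟨⟨fun _ => ⟨1, h2, rfl⟩, fun _ => ⟨2, ha₁, rfl⟩, fun i => i.elim0⟩,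
      ⟨fun _ => ⟨1, h1.neg, rfl⟩, fun _ => ⟨2, ha₂, rfl⟩, fun i => i.elim0⟩,
      ⟨fun h => absurd rfl h, fun _ => ⟨1, hl1.neg, rfl⟩, fun i => i.elim0⟩, fun i => i.elim0⟩
  · exact fun _ s => s.elim0
  · rw [Matrix.range_cons, Matrix.range_cons_cons_empty, Set.singleton_union]
  · intro v
    constructor
    · intro hv
      simp only [dotProduct, Fin.sum_univ_three, Matrix.cons_val_zero, Matrix.cons_val_one,
        Matrix.cons_val] at hv
      have h3 : c * v 2 ∈ Ideal.span {l} := Ideal.mem_span_singleton.2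
        ⟨-(l₁ * v 0 + l₂ * v 1), by linear_combination hv⟩
      obtain ⟨w, hw⟩ := Ideal.mem_span_singleton.1 ((hp.mem_or_mem h3).resolve_left hcl)
      have h4 : l₁ * (v 0 + a₁ * w) + l₂ * (v 1 + a₂ * w) = 0 := by
        apply mul_left_cancel₀ hl
        rw [hce, hw] at hv
        linear_combination hv
      obtain ⟨m, hm0, hm1⟩ := exists_of_syzygy h10 (span_linear_regular h1 h2 h) h4
      refine ⟨![m, -w], ?_⟩
      ext i : 1
      fin_cases i
      · simp [Matrix.mulVec, dotProduct, Fin.sum_univ_two]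
        linear_combination -hm0
      · simp [Matrix.mulVec, dotProduct, Fin.sum_univ_two]
        linear_combination -hm1
      · simp [Matrix.mulVec, dotProduct, Fin.sum_univ_two, hw]
    · rintro ⟨w, rfl⟩
      simp [Matrix.mulVec, dotProduct, Fin.sum_univ_succ, hce]
      ring
  · intro v
    constructor
    · intro hv
      refine ⟨0, ?_⟩
      have e1 := congrFun hv 2
      have e0 := congrFun hv 0
      simp [Matrix.mulVec, dotProduct, Fin.sum_univ_two, hl] at e1
      simp [Matrix.mulVec, dotProduct, Fin.sum_univ_two, e1, h20] at e0
      ext i : 1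
      fin_cases i <;> simp [e0, e1]
    · rintro ⟨w, rfl⟩
      simp
  · exact fun v _ => funext fun i => i.elim0
  · simp [Fin.forall_fin_succ]
  · simp [Fin.forall_fin_two]
  · exact fun i => i.elim0

/-- With `p = a₁ * l₁ + a₂ * l₂ + a₃ * q`, the first three relations are the Koszul relations of
`l₁, l₂, q`, and the fourth expresses `l * p` through `l * l₁, l * l₂, l * q`. The only second
syzygy is the Koszul one. -/
theorem isRegular_four_of_quartic {l l₁ l₂ q p : CoordRing k} (hl1 : l.IsHomogeneous 1)
    (hl : l ≠ 0) (h1 : l₁.IsHomogeneous 1) (h2 : l₂.IsHomogeneous 1)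
    (h : LinearIndependent k ![l₁, l₂]) (hq2 : q.IsHomogeneous 2) (hq : q ∉ Ideal.span {l₁, l₂})
    (hp4 : p.IsHomogeneous 4) (hp : p ∈ Ideal.span {l₁, l₂, q}) (hpl : p ∉ Ideal.span {l}) :
    IsRegular (Ideal.span {l * l₁, l * l₂, l * q, p}) 4 := by
  have hprime := isPrime_span_linear hl1 hl
  have hprime2 := isPrime_span_pair h1 h2 h
  have h10 : l₁ ≠ 0 := h.ne_zero 0
  have h20 : l₂ ≠ 0 := h.ne_zero 1
  rw [span_triple_eq_sup] at hp
  obtain ⟨a₃, ha₃, hp'⟩ := exists_homogeneous_of_mem_sup_span (n := 2)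
    (isHomogeneousIdeal_span_pair h1 h2) hq2 hp4 hp
  rw [span_pair_eq_sup] at hp'
  have hh : (p - a₃ * q).IsHomogeneous (3 + 1) := hp4.sub (ha₃.mul hq2)
  obtain ⟨a₁, ha₁, hp''⟩ := exists_homogeneous_of_mem_sup_span
    (isHomogeneousIdeal_span_singleton h2) h1 hh hp'
  have hh' : (p - a₃ * q - a₁ * l₁).IsHomogeneous (3 + 1) := hh.sub (ha₁.mul h1)
  obtain ⟨a₂, ha₂, hp'''⟩ := exists_homogeneous_of_mem_sup_span isHomogeneousIdeal_bot h2 hh'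
    (by simpa using hp'')
  rw [Ideal.mem_bot] at hp'''
  have hpe : p = a₁ * l₁ + a₂ * l₂ + a₃ * q := by linear_combination hp'''
  refine isRegular_of_resolutionOfLengthTwo (m := 4) ![2, 2, 3, 4] ![3, 4, 4, 5] ![5]
    ![l * l₁, l * l₂, l * q, p]
    !![l₂, q, 0, a₁; -l₁, 0, q, a₂; 0, -l₁, -l₂, a₃; 0, 0, 0, -l]
    !![q; -l₂; l₁; 0] ?_ ?_ ?_ ?_ ?_ ?_ ?_ ?_ ?_ ?_
  · simp only [Fin.forall_fin_succ]
    exact ⟨hl1.mul h1, hl1.mul h2, hl1.mul hq2, hp4, fun i => i.elim0⟩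
  · simp only [Fin.forall_fin_succ]
    exact ⟨⟨fun _ => ⟨1, h2, rfl⟩, fun _ => ⟨2, hq2, rfl⟩, fun h => absurd rfl h,
        fun _ => ⟨3, ha₁, rfl⟩, fun i => i.elim0⟩,
      ⟨fun _ => ⟨1, h1.neg, rfl⟩, fun h => absurd rfl h, fun _ => ⟨2, hq2, rfl⟩,
        fun _ => ⟨3, ha₂, rfl⟩, fun i => i.elim0⟩,
      ⟨fun h => absurd rfl h, fun _ => ⟨1, h1.neg, rfl⟩, fun _ => ⟨1, h2.neg, rfl⟩,
        fun _ => ⟨2, ha₃, rfl⟩, fun i => i.elim0⟩,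
      ⟨fun h => absurd rfl h, fun h => absurd rfl h, fun h => absurd rfl h,
        fun _ => ⟨1, hl1.neg, rfl⟩, fun i => i.elim0⟩, fun i => i.elim0⟩
  · simp only [Fin.forall_fin_succ]
    exact ⟨⟨fun _ => ⟨2, hq2, rfl⟩, fun i => i.elim0⟩,
      ⟨fun _ => ⟨1, h2.neg, rfl⟩, fun i => i.elim0⟩,
      ⟨fun _ => ⟨1, h1, rfl⟩, fun i => i.elim0⟩, ⟨fun h => absurd rfl h, fun i => i.elim0⟩,
      fun i => i.elim0⟩
  · rw [Matrix.range_cons, Matrix.range_cons, Matrix.range_cons_cons_empty, Set.singleton_union,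
      Set.singleton_union]
  · intro v
    constructor
    · intro hv
      simp only [dotProduct, Fin.sum_univ_four, Matrix.cons_val_zero, Matrix.cons_val_one,
        Matrix.cons_val] at hv
      -- Modulo the prime `(l)` only the term with `p` survives, so `l` divides `v 3`. Removing a
      -- multiple of the fourth relation leaves a syzygy of the regular sequence `l₁, l₂, q`.
      have h3 : p * v 3 ∈ Ideal.span {l} := Ideal.mem_span_singleton.2
        ⟨-(l₁ * v 0 + l₂ * v 1 + q * v 2), by linear_combination hv⟩
      obtain ⟨w, hw⟩ := Ideal.mem_span_singleton.1 ((hprime.mem_or_mem h3).resolve_left hpl)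
      have h4 : l₁ * (v 0 + a₁ * w) + l₂ * (v 1 + a₂ * w) + q * (v 2 + a₃ * w) = 0 := by
        apply mul_left_cancel₀ hl
        rw [hpe, hw] at hv
        linear_combination hv
      have h5 : q * (v 2 + a₃ * w) ∈ Ideal.span {l₁, l₂} := Ideal.mem_span_pair.2
        ⟨-(v 0 + a₁ * w), -(v 1 + a₂ * w), by linear_combination -h4⟩
      obtain ⟨s, t, hst⟩ := Ideal.mem_span_pair.1 ((hprime2.mem_or_mem h5).resolve_left hq)
      have h6 : l₁ * (v 0 + a₁ * w + q * s) + l₂ * (v 1 + a₂ * w + q * t) = 0 := by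
        linear_combination h4 + q * hst
      obtain ⟨m, hm0, hm1⟩ := exists_of_syzygy h10 (span_linear_regular h1 h2 h) h6
      refine ⟨![m, -s, -t, -w], ?_⟩
      ext i : 1
      fin_cases i
      · simp [Matrix.mulVec, dotProduct, Fin.sum_univ_four]
        linear_combination -hm0
      · simp [Matrix.mulVec, dotProduct, Fin.sum_univ_four]
        linear_combination -hm1
      · simp [Matrix.mulVec, dotProduct, Fin.sum_univ_four]
        linear_combination hst
      · simp [Matrix.mulVec, dotProduct, Fin.sum_univ_four, hw]
    · rintro ⟨w, rfl⟩
      simp [Matrix.mulVec, dotProduct, Fin.sum_univ_four, hpe]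
      ring
  · intro v
    constructor
    · intro hv
      have e3 := congrFun hv 3
      have e2 := congrFun hv 2
      have e0 := congrFun hv 0
      simp [Matrix.mulVec, dotProduct, Fin.sum_univ_four, hl] at e3
      simp [Matrix.mulVec, dotProduct, Fin.sum_univ_four, e3] at e2
      simp [Matrix.mulVec, dotProduct, Fin.sum_univ_four, e3] at e0
      have h6 : l₁ * v 1 + l₂ * v 2 = 0 := by linear_combination -e2
      obtain ⟨m, hm0, hm1⟩ := exists_of_syzygy h10 (span_linear_regular h1 h2 h) h6
      have h7 : v 0 = -(q * m) := by
        apply mul_left_cancel₀ h20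
        rw [hm0] at e0
        linear_combination e0
      refine ⟨![-m], ?_⟩
      ext i : 1
      fin_cases i <;> simp [Matrix.mulVec, dotProduct, hm0, hm1, h7, e3]
    · rintro ⟨w, rfl⟩
      ext i : 1
      fin_cases i <;> simp [Matrix.mulVec, dotProduct, Fin.sum_univ_four] <;> ring
  · intro v hv
    have e2 := congrFun hv 2
    simp [Matrix.mulVec, dotProduct, h10] at e2
    ext i : 1
    fin_cases i
    simp [e2]
  · simp [Fin.forall_fin_succ]
  · simp [Fin.forall_fin_succ]
  · simp

/-! ### Factors of forms and pairs of quadrics -/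

/-- Both the lowest degree (the order as a power series) and the total degree are additive on
products. They agree on `d * e`, so they agree on each factor. -/
theorem isHomogeneous_of_mul {d e : CoordRing k} {n : ℕ} (hn : (d * e).IsHomogeneous n)
    (h0 : d * e ≠ 0) : d.IsHomogeneous d.totalDegree ∧ d.totalDegree + e.totalDegree = n := by
  have hd0 := left_ne_zero_of_mul h0
  have he0 := right_ne_zero_of_mul h0
  have htot : d.totalDegree + e.totalDegree = n := by
    rw [← totalDegree_mul_of_isDomain hd0 he0, hn.totalDegree h0]
  have hle : ∀ f : CoordRing k, f ≠ 0 → (f : MvPowerSeries (Fin 4) k).order ≤ f.totalDegree := by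
    intro f hf
    obtain ⟨m, hm⟩ := exists_coeff_ne_zero hf
    refine (MvPowerSeries.order_le (d := m) (by simpa using hm)).trans ?_
    exact_mod_cast le_totalDegree (mem_support_iff.2 hm)
  have hge : (n : ℕ∞) ≤ (d : MvPowerSeries (Fin 4) k).order +
      (e : MvPowerSeries (Fin 4) k).order := by
    rw [← MvPowerSeries.order_mul, ← coe_mul]
    refine MvPowerSeries.nat_le_order fun m hm => ?_
    rw [coeff_coe]
    exact hn.coeff_eq_zero hm.ne
  have hd : (d.totalDegree : ℕ∞) ≤ (d : MvPowerSeries (Fin 4) k).order := by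
    have h1 := hge.trans (add_le_add_right (hle e he0) _)
    rw [← htot, Nat.cast_add] at h1
    exact (ENat.add_le_add_iff_right (ENat.natCast_ne_top _)).1 h1
  refine ⟨?_, htot⟩
  intro m hm
  have h1 := (hd.trans (MvPowerSeries.order_le (f := (d : MvPowerSeries (Fin 4) k)) (d := m)
    (by simpa using hm)))
  have h2 : m.degree ≤ d.totalDegree := le_totalDegree (mem_support_iff.2 hm)
  have h3 : d.totalDegree ≤ m.degree := by exact_mod_cast h1
  have h4 : Finsupp.weight (1 : Fin 4 → ℕ) m = m.degree :=
    (DFunLike.congr_fun Finsupp.degree_eq_weight_one m).symm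
  exact h4.trans (le_antisymm h2 h3)

theorem eq_C_of_isHomogeneous_zero {f : CoordRing k} (hf : f.IsHomogeneous 0) :
    ∃ c, f = C c :=
  ⟨_, totalDegree_eq_zero_iff_eq_C.1 ((totalDegree_zero_iff_isHomogeneous (Fin 4)).2 hf)⟩

/-- Two independent quadrics that do not form a regular sequence share a linear factor. -/
theorem exists_common_linear_factor {q₁ q₂ : CoordRing k} (h1 : q₁.IsHomogeneous 2)
    (h2 : q₂.IsHomogeneous 2) (h : LinearIndependent k ![q₁, q₂])
    (hq : ¬ ∀ a, q₂ * a ∈ Ideal.span {q₁} → a ∈ Ideal.span {q₁}) :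
    ∃ l l₁ l₂ : CoordRing k, l.IsHomogeneous 1 ∧ l ≠ 0 ∧ l₁.IsHomogeneous 1 ∧
      l₂.IsHomogeneous 1 ∧ LinearIndependent k ![l₁, l₂] ∧ q₁ = l * l₁ ∧ q₂ = l * l₂ := by
  have h10 : q₁ ≠ 0 := h.ne_zero 0
  have h20 : q₂ ≠ 0 := h.ne_zero 1
  -- By unique factorization, coprime quadrics form a regular sequence; a common factor that is not
  -- a unit therefore exists.
  have hrel : ¬ IsRelPrime q₁ q₂ := by
    intro hr
    apply hq
    intro a ha
    rw [Ideal.mem_span_singleton] at ha ⊢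
    exact hr.dvd_of_dvd_mul_left ha
  simp only [IsRelPrime, not_forall] at hrel
  obtain ⟨l, ⟨l₁, rfl⟩, ⟨l₂, rfl⟩, hunit⟩ := hrel
  obtain ⟨hlh, e1⟩ := isHomogeneous_of_mul h1 h10
  obtain ⟨-, e2⟩ := isHomogeneous_of_mul h2 h20
  have hl0 : l ≠ 0 := left_ne_zero_of_mul h10
  obtain ⟨hl1h, -⟩ := isHomogeneous_of_mul (mul_comm l l₁ ▸ h1) (mul_comm l l₁ ▸ h10)
  obtain ⟨hl2h, -⟩ := isHomogeneous_of_mul (mul_comm l l₂ ▸ h2) (mul_comm l l₂ ▸ h20)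
  have hli : LinearIndependent k ![l₁, l₂] := by
    refine LinearIndependent.of_comp (LinearMap.mulLeft k l) ?_
    have e : LinearMap.mulLeft k l ∘ ![l₁, l₂] = ![l * l₁, l * l₂] := by
      ext i : 1
      fin_cases i <;> simp
    rw [e]
    exact h
  have hne0 : l.totalDegree ≠ 0 := by
    intro h0
    rw [h0] at hlh
    obtain ⟨c, rfl⟩ := eq_C_of_isHomogeneous_zero hlh
    apply hunit
    refine (IsUnit.mk0 c ?_).map C
    rintro rfl
    simp at hl0
  -- With a quadratic common factor both cofactors would be constants, hence linearly dependent.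
  have hne2 : l.totalDegree ≠ 2 := by
    intro h0
    rw [show l₁.totalDegree = 0 by omega] at hl1h
    rw [show l₂.totalDegree = 0 by omega] at hl2h
    obtain ⟨c₁, rfl⟩ := eq_C_of_isHomogeneous_zero hl1h
    obtain ⟨c₂, rfl⟩ := eq_C_of_isHomogeneous_zero hl2h
    have h3 := (LinearIndependent.pair_iff.1 hli) c₂ (-c₁) (by
      rw [smul_eq_C_mul, smul_eq_C_mul, map_neg]
      ring)
    rw [h3.1] at h20
    simp at h20
  have hl : l.totalDegree = 1 := by omega
  rw [hl] at hlh
  rw [show l₁.totalDegree = 1 by omega] at hl1h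
  rw [show l₂.totalDegree = 1 by omega] at hl2h
  exact ⟨l, l₁, l₂, hlh, hl0, hl1h, hl2h, hli, rfl, rfl⟩

/-! ### Identifying ideals through their Hilbert functions -/

theorem hilbertFunction_le_of_forall {J K : Ideal (CoordRing k)} {n : ℕ}
    (h : ∀ f ∈ K, f.IsHomogeneous n → f ∈ J) : hilbertFunction J n ≤ hilbertFunction K n := by
  have h1 := hilbertFunction_add J n
  have h2 := hilbertFunction_add K n
  have h3 : gradedPiece K n ≤ gradedPiece J n := fun x hx => h x hx x.2
  have := Submodule.finrank_mono h3
  omega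

theorem IsHomogeneousIdeal.le_of_hilbertFunction_le {J K : Ideal (CoordRing k)}
    (hK : IsHomogeneousIdeal K) (h : J ≤ K) (hn : ∀ n, hilbertFunction J n ≤ hilbertFunction K n) :
    K ≤ J :=
  hK.le_of_forall fun n _ hf hfn => mem_of_hilbertFunction_le h (hn n) hfn hf

theorem exists_linearIndependent_pair_mem {I : Ideal (CoordRing k)}
    (h : hilbertFunction I 2 ≤ 8) : ∃ q₁ q₂ : CoordRing k, q₁.IsHomogeneous 2 ∧
      q₂.IsHomogeneous 2 ∧ q₁ ∈ I ∧ q₂ ∈ I ∧ LinearIndependent k ![q₁, q₂] := by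
  set W := (gradedPiece I 2).map (homogeneousSubmodule (Fin 4) k 2).subtype
  have hW : ∀ x ∈ W, x.IsHomogeneous 2 ∧ x ∈ I := by
    rintro _ ⟨y, hy, rfl⟩
    exact ⟨y.2, hy⟩
  have hrank : 2 ≤ Module.finrank k W := by
    have e1 : Module.finrank k W = Module.finrank k (gradedPiece I 2) :=
      Submodule.finrank_map_subtype_eq _ _
    have e2 := hilbertFunction_add I 2
    have e3 := hilbertFunction_add (⊥ : Ideal (CoordRing k)) 2
    have e4 := hilbertFunction_bot (k := k) 2
    omega
  obtain ⟨q₂, hq₂, h2⟩ := exists_linearIndependent_cons_mem W (v := ![])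
    linearIndependent_empty_type (fun i => i.elim0) (zero_lt_two.trans_le hrank)
  obtain ⟨q₁, hq₁, h1⟩ := exists_linearIndependent_cons_mem W (v := ![q₂]) h2
    (by simpa using hq₂) (one_lt_two.trans_le hrank)
  exact ⟨q₁, q₂, (hW _ hq₁).1, (hW _ hq₂).1, (hW _ hq₁).2, (hW _ hq₂).2, h1⟩

theorem hilbertFunction_completeIntersection {q₁ q₂ : CoordRing k} (h1 : q₁.IsHomogeneous 2)
    (h2 : q₂.IsHomogeneous 2) (h0 : q₁ ≠ 0)
    (h : ∀ a, q₂ * a ∈ Ideal.span {q₁} → a ∈ Ideal.span {q₁}) (n : ℕ) :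
    hilbertFunction (Ideal.span {q₁} ⊔ Ideal.span {q₂}) (n + 4) = 4 * (n + 4) := by
  have e1 := hilbertFunction_sup_span_of_regular (isHomogeneousIdeal_span_singleton h1) h2 h (n + 2)
  have hreg : ∀ a, q₁ * a ∈ (⊥ : Ideal (CoordRing k)) → a ∈ (⊥ : Ideal (CoordRing k)) := by
    intro a ha
    simpa [h0] using ha
  have e2 := hilbertFunction_sup_span_of_regular isHomogeneousIdeal_bot h1 hreg (n + 2)
  have e3 := hilbertFunction_sup_span_of_regular isHomogeneousIdeal_bot h1 hreg n
  rw [bot_sup_eq] at e2 e3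
  have b0 := hilbertFunction_bot (k := k) n
  have b2 := hilbertFunction_bot (k := k) (n + 2)
  have b4 := hilbertFunction_bot (k := k) (n + 4)
  rw [add_assoc] at e1 e2
  norm_num at e1 e2
  ring_nf at b0 b2 b4 e1 e2 e3 ⊢
  omega

/-- A saturated ideal containing a complete intersection with the same Hilbert polynomial is equal
to it. -/
theorem eq_completeIntersection [IsAlgClosed k] {I : Ideal (CoordRing k)}
    (hI : IsHomogeneousIdeal I) {N : ℕ} (hN : ∀ n ≥ N, hilbertFunction I n = 4 * n)
    {q₁ q₂ : CoordRing k} (h1 : q₁.IsHomogeneous 2) (h2 : q₂.IsHomogeneous 2) (h0 : q₁ ≠ 0)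
    (h : ∀ a, q₂ * a ∈ Ideal.span {q₁} → a ∈ Ideal.span {q₁}) (h1I : q₁ ∈ I) (h2I : q₂ ∈ I) :
    I = Ideal.span {q₁, q₂} := by
  rw [Ideal.span_insert]
  have hle : Ideal.span {q₁} ⊔ Ideal.span {q₂} ≤ I := by
    simp [Ideal.span_le, h1I, h2I]
  refine le_antisymm (hI.le_of_forall fun e g hg hge => ?_) hle
  -- Multiplying by forms of degree `N + 4` reaches degrees where both Hilbert functions equal 4n,
  -- so the two ideals agree there; saturation of the complete intersection brings `g` back.
  refine isSaturated_span_pair h0 h g (N + 4) fun a ha => ?_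
  rw [mul_comm]
  refine irrelevantIdeal_pow_le (J := colonBy (Ideal.span {q₁} ⊔ Ideal.span {q₂}) g)
    (fun b hb => ?_) ha
  refine mem_of_hilbertFunction_le hle ?_ (hge.mul hb) (I.mul_mem_right _ hg)
  rw [hN _ (by omega), show e + (N + 4) = (e + N) + 4 by ring,
    hilbertFunction_completeIntersection h1 h2 h0 h]

/-- An ideal containing the ideal of a plane curve and having, up to a constant, the same Hilbert
function is equal to it. -/
theorem le_planeCurve_of_hilbertFunction [IsAlgClosed k] {M : Ideal (CoordRing k)}
    (hM : IsHomogeneousIdeal M) {l f : CoordRing k} (hl1 : l.IsHomogeneous 1) (hl : l ≠ 0) {d : ℕ}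
    (hf : f.IsHomogeneous d) (hfl : f ∉ Ideal.span {l})
    (hle : Ideal.span {l} ⊔ Ideal.span {f} ≤ M) {N B : ℕ}
    (hB : ∀ n ≥ N, hilbertFunction (Ideal.span {l} ⊔ Ideal.span {f}) n ≤ hilbertFunction M n + B) :
    M ≤ Ideal.span {l} ⊔ Ideal.span {f} := by
  refine hM.le_of_forall fun e g hg hge => ?_
  by_contra hgJ
  -- Adding `g` lowers the Hilbert function by at least `N + B + 1` in this degree, more than the
  -- permitted `B`.
  have h1 := hilbertFunction_planeCurve_sup_span hl1 hl hf hfl hge hgJ (N + B)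
  have h2 := hB (N + B + e) (by omega)
  have h3 : Ideal.span {l} ⊔ Ideal.span {f} ⊔ Ideal.span {g} ≤ M :=
    sup_le hle ((Ideal.span_singleton_le_iff_mem M).2 hg)
  have h4 := hilbertFunction_anti h3 (N + B + e)
  omega

/-- An element of `I` has the form `l * a + b * f`; as `f ∈ I`, also `l * a ∈ I`, that is, `a ∈ I :
l`. -/
theorem eq_mul_colonBy_sup {I : Ideal (CoordRing k)} {l f : CoordRing k} (hf : f ∈ I)
    (h : I ⊔ Ideal.span {l} ≤ Ideal.span {l} ⊔ Ideal.span {f}) :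
    I = Ideal.span {l} * colonBy I l ⊔ Ideal.span {f} := by
  apply le_antisymm
  · intro g hg
    obtain ⟨x, hx, y, hy, rfl⟩ := Submodule.mem_sup.1 (h (Ideal.mem_sup_left hg))
    obtain ⟨a, rfl⟩ := Ideal.mem_span_singleton.1 hx
    refine add_mem (Ideal.mem_sup_left ?_) (Ideal.mem_sup_right hy)
    refine Ideal.mul_mem_mul (Ideal.mem_span_singleton_self l) ?_
    have hyI : y ∈ I := (Ideal.span_singleton_le_iff_mem I).2 hf hy
    rw [mem_colonBy, ← add_sub_cancel_right (l * a) y]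
    exact sub_mem hg hyI
  · refine sup_le ?_ ((Ideal.span_singleton_le_iff_mem I).2 hf)
    rw [Ideal.span_singleton_mul_le_iff]
    exact fun _ ha => ha

theorem IsSaturated.colonBy {I : Ideal (CoordRing k)} (hI : IsSaturated I) (f : CoordRing k) :
    IsSaturated (SpaceCurves.colonBy I f) := by
  intro g N hN
  refine hI _ N fun a ha => ?_
  rw [mul_left_comm]
  exact hN a ha

theorem IsSaturated.hilbertFunction_mono [Infinite k] {S : Ideal (CoordRing k)}
    (hsat : IsSaturated S) (hS : IsHomogeneousIdeal S) : Monotone (hilbertFunction S) := by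
  obtain ⟨u, hu1, hu⟩ := exists_regular_linearForm hsat
  refine monotone_nat_of_le_succ fun n => ?_
  rw [hilbertFunction_sup_span_of_regular hS hu1 hu]
  omega

/-- A saturated ideal of a subscheme of length two of a line. -/
theorem eq_span_triple_of_hilbertFunction [Infinite k] {K : Ideal (CoordRing k)}
    (hK : IsHomogeneousIdeal K) (hsat : IsSaturated K) {l₁ l₂ : CoordRing k}
    (h1 : l₁.IsHomogeneous 1) (h2 : l₂.IsHomogeneous 1) (h : LinearIndependent k ![l₁, l₂])
    (h1K : l₁ ∈ K) (h2K : l₂ ∈ K) {N : ℕ} (hN : ∀ n ≥ N, hilbertFunction K n = 2) :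
    ∃ q : CoordRing k, q.IsHomogeneous 2 ∧ q ∉ Ideal.span {l₁, l₂} ∧
      K = Ideal.span {l₁, l₂, q} := by
  have hge := hilbertFunction_saturated_ge hK hsat hN
  have hle : Ideal.span {l₁, l₂} ≤ K := by
    simp [Ideal.span_le, Set.insert_subset_iff, h1K, h2K]
  have hpair := hilbertFunction_span_pair h1 h2 h
  -- In degree 2 the line has Hilbert function 3, while that of `K`, being monotone with final value
  -- 2, is at most 2.
  obtain ⟨q, hqK, hq2, hq⟩ : ∃ q ∈ K, q.IsHomogeneous 2 ∧ q ∉ Ideal.span {l₁, l₂} := by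
    by_contra! hcon
    have e1 := hilbertFunction_le_of_forall hcon
    have e2 := hsat.hilbertFunction_mono hK (show 2 ≤ N + 2 by omega)
    rw [hN (N + 2) (by omega)] at e2
    rw [hpair] at e1
    omega
  refine ⟨q, hq2, hq, ?_⟩
  have hle' : Ideal.span {l₁, l₂, q} ≤ K := by
    simp [Ideal.span_le, Set.insert_subset_iff, h1K, h2K, hqK]
  refine le_antisymm (hK.le_of_hilbertFunction_le hle' fun n => ?_) hle'
  refine le_trans ?_ (hge n)
  have e1 : hilbertFunction (Ideal.span {l₁, l₂, q}) n ≤ n + 1 := by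
    rw [← hpair n, span_triple_eq_sup]
    exact hilbertFunction_anti le_sup_left n
  rcases le_or_gt 2 n with hn | hn
  · obtain ⟨m, rfl⟩ := Nat.exists_eq_add_of_le' hn
    rw [hilbertFunction_span_triple h1 h2 h hq2 hq]
    omega
  · omega

theorem hilbertFunction_planeQuartic {l f : CoordRing k} (hl1 : l.IsHomogeneous 1) (hl : l ≠ 0)
    (hf : f.IsHomogeneous 4) (hfl : f ∉ Ideal.span {l}) (n : ℕ) :
    hilbertFunction (Ideal.span {l} ⊔ Ideal.span {f}) (n + 4) = 4 * n + 14 := by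
  have := hilbertFunction_planeCurve hl1 hl hf hfl n
  ring_nf at this ⊢
  omega

theorem hilbertFunction_planeCubic {l f : CoordRing k} (hl1 : l.IsHomogeneous 1) (hl : l ≠ 0)
    (hf : f.IsHomogeneous 3) (hfl : f ∉ Ideal.span {l}) (n : ℕ) :
    hilbertFunction (Ideal.span {l} ⊔ Ideal.span {f}) (n + 3) = 3 * n + 9 := by
  have := hilbertFunction_planeCurve hl1 hl hf hfl n
  ring_nf at this ⊢
  omega

theorem hilbertFunction_planeCurve_le {l f : CoordRing k} (hl1 : l.IsHomogeneous 1) (hl : l ≠ 0)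
    {d : ℕ} (hd : d ≤ 3) (hf : f.IsHomogeneous d) (hfl : f ∉ Ideal.span {l}) {n : ℕ} (hn : 3 ≤ n) :
    hilbertFunction (Ideal.span {l} ⊔ Ideal.span {f}) n ≤ 3 * n := by
  obtain ⟨m, rfl⟩ := Nat.exists_eq_add_of_le' (hd.trans hn)
  have := hilbertFunction_planeCurve hl1 hl hf hfl m
  interval_cases d <;> ring_nf at this ⊢ <;> omega

theorem GradedFreeResolution.aug_mem {I : Ideal (CoordRing k)} (F : GradedFreeResolution I)
    (r : Fin (F.rank 0)) : F.aug r ∈ I :=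
  F.span_aug.le (Ideal.subset_span (Set.mem_range_self r))

theorem GradedFreeResolution.le_of_aug_mem {I J : Ideal (CoordRing k)}
    (F : GradedFreeResolution I) (h : ∀ r, F.aug r ∈ J) : I ≤ J := by
  rw [← F.span_aug, Ideal.span_le]
  rintro _ ⟨r, rfl⟩
  exact h r

theorem span_mul_span_pair (l l₁ l₂ : CoordRing k) :
    Ideal.span {l} * Ideal.span {l₁, l₂} = Ideal.span {l * l₁, l * l₂} := by
  rw [Ideal.span_insert, Ideal.span_insert, Ideal.mul_sup, Ideal.span_singleton_mul_span_singleton,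
    Ideal.span_singleton_mul_span_singleton]

theorem span_mul_span_triple (l l₁ l₂ q : CoordRing k) :
    Ideal.span {l} * Ideal.span {l₁, l₂, q} = Ideal.span {l * l₁, l * l₂, l * q} := by
  rw [span_triple_eq_sup, span_triple_eq_sup, Ideal.mul_sup, span_mul_span_pair,
    Ideal.span_singleton_mul_span_singleton]

/-- The case where the residual scheme of the plane `l` is a line: `I` is 3-regular. -/
theorem isRegular_three_of_colonBy_eq [IsAlgClosed k] {I : Ideal (CoordRing k)}
    (hI : IsHomogeneousIdeal I) (hsat : IsSaturated I) {N : ℕ}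
    (hN : ∀ n ≥ N, hilbertFunction I n = 4 * n) {l l₁ l₂ : CoordRing k} (hl1 : l.IsHomogeneous 1)
    (hl : l ≠ 0) (h1 : l₁.IsHomogeneous 1) (h2 : l₂.IsHomogeneous 1)
    (h : LinearIndependent k ![l₁, l₂]) (hK : colonBy I l = Ideal.span {l₁, l₂}) :
    IsRegular I 3 := by
  have : Infinite k := IsAlgClosed.instInfinite
  have step := hilbertFunction_sup_span hI hl1 (K := colonBy I l) (fun _ => Iff.rfl)
  rw [hK] at step
  simp only [hilbertFunction_span_pair h1 h2 h] at step
  -- In degree 3, `P/I` has dimension at most 12 and the residual line contributes 3. This leaves at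
  -- most 9 for `I + (l)`, while `(l)` alone has 10.
  obtain ⟨c, hcI, hc3, hcl⟩ : ∃ c ∈ I, c.IsHomogeneous 3 ∧ c ∉ Ideal.span {l} := by
    by_contra! hcon
    have e1 : hilbertFunction (Ideal.span {l}) 3 ≤ hilbertFunction (I ⊔ Ideal.span {l}) 3 := by
      refine hilbertFunction_le_of_forall fun g hg hg3 => ?_
      obtain ⟨a, ha, hag⟩ := exists_homogeneous_of_mem_sup_span (n := 2) hI hl1 hg3 hg
      have := hcon _ hag (hg3.sub (ha.mul hl1))
      rw [← sub_add_cancel g (a * l)]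
      exact add_mem this (Ideal.mul_mem_left _ _ (Ideal.mem_span_singleton_self l))
    have e2 := hilbertFunction_span_linear hl1 hl 3
    have e3 := hilbertFunction_le_four_mul hI hsat hN (show 2 ≤ 3 by norm_num)
    have e4 := step 2
    rw [show 2 + 1 = 3 from rfl] at e4
    omega
  have hle : Ideal.span {l} ⊔ Ideal.span {c} ≤ I ⊔ Ideal.span {l} :=
    sup_le le_sup_right (((Ideal.span_singleton_le_iff_mem I).2 hcI).trans le_sup_left)
  have hcurve := le_planeCurve_of_hilbertFunction (hI.sup_span hl1) hl1 hl hc3 hcl hle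
    (N := N + 3) (B := 0) (fun n hn => by
      obtain ⟨m, rfl⟩ := Nat.exists_eq_add_of_le' (show 3 ≤ n by omega)
      have e1 := hilbertFunction_planeCubic hl1 hl hc3 hcl m
      have e2 := step (m + 2)
      rw [hN _ (by omega), show m + 2 + 1 = m + 3 from rfl] at e2
      omega)
  have hIeq := eq_mul_colonBy_sup hcI hcurve
  rw [hK, span_mul_span_pair, ← span_triple_eq_sup] at hIeq
  have hc : c ∈ Ideal.span {l₁, l₂} := hK ▸ le_colonBy I l hcI
  rw [hIeq]
  exact isRegular_three_of_cubic hl1 hl h1 h2 h hc3 hc hcl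

/-- The case where `I` contains two quadrics with the common factor `l`. -/
theorem exists_form_of_common_factor [IsAlgClosed k] {I : Ideal (CoordRing k)}
    (hI : IsHomogeneousIdeal I) (hsat : IsSaturated I) {N : ℕ}
    (hN : ∀ n ≥ N, hilbertFunction I n = 4 * n) (h4 : IsRegular I 4) (h3 : ¬ IsRegular I 3)
    {l l₁ l₂ : CoordRing k} (hl1 : l.IsHomogeneous 1)
    (hl : l ≠ 0) (h1 : l₁.IsHomogeneous 1) (h2 : l₂.IsHomogeneous 1)
    (h : LinearIndependent k ![l₁, l₂]) (h1I : l * l₁ ∈ I) (h2I : l * l₂ ∈ I) :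
    ∃ q p : CoordRing k, q.IsHomogeneous 2 ∧ q ∉ Ideal.span {l₁, l₂} ∧
      p.IsHomogeneous 4 ∧ p ∈ Ideal.span {l₁, l₂, q} ∧ p ∉ Ideal.span {l} ∧
      I = Ideal.span {l} * Ideal.span {l₁, l₂, q} ⊔ Ideal.span {p} := by
  have : Infinite k := IsAlgClosed.instInfinite
  have hKhom := hI.colon hl1
  have step := hilbertFunction_sup_span hI hl1 (K := colonBy I l) (fun _ => Iff.rfl)
  have hleK : Ideal.span {l₁, l₂} ≤ colonBy I l := by
    simp [Ideal.span_le, Set.insert_subset_iff, mem_colonBy, h1I, h2I]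
  obtain ⟨e, g, hgK, hge, hg⟩ : ∃ e, ∃ g ∈ colonBy I l, g.IsHomogeneous e ∧
      g ∉ Ideal.span {l₁, l₂} := by
    by_contra! hcon
    exact h3 (isRegular_three_of_colonBy_eq hI hsat hN hl1 hl h1 h2 h
      (le_antisymm (hKhom.le_of_forall hcon) hleK))
  have hKle : ∀ n, hilbertFunction (colonBy I l) (n + e) ≤ e := by
    intro n
    refine (hilbertFunction_anti ?_ _).trans_eq (hilbertFunction_span_triple h1 h2 h hge hg n)
    rw [span_triple_eq_sup]
    exact sup_le hleK ((Ideal.span_singleton_le_iff_mem _).2 hgK)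
  obtain ⟨F, hF⟩ := h4
  -- Otherwise `I ⊆ (l)`, and the Hilbert function would grow quadratically.
  obtain ⟨r, hr⟩ : ∃ r, F.aug r ∉ Ideal.span {l} := by
    by_contra! hcon
    have e1 := hilbertFunction_anti (F.le_of_aug_mem hcon) (N + 6)
    have e2 := hilbertFunction_span_linear hl1 hl (N + 6)
    rw [hN _ (by omega)] at e1
    nlinarith
  have hfI := F.aug_mem r
  have hd := hF 0 r
  have hfd := F.aug_homogeneous r
  generalize F.aug r = f at hr hfI hfd
  generalize F.deg 0 r = d at hd hfd
  have hle : Ideal.span {l} ⊔ Ideal.span {f} ≤ I ⊔ Ideal.span {l} :=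
    sup_le le_sup_right (((Ideal.span_singleton_le_iff_mem I).2 hfI).trans le_sup_left)
  -- A plane curve of degree at most 3 has Hilbert function at most 3n for n ≥ 3, but that of `I +
  -- (l)` is eventually at least 4n - e.
  obtain rfl : d = 4 := by
    by_contra hd4
    have hd3 : d ≤ 3 := by
      norm_num at hd
      omega
    have e1 := hilbertFunction_planeCurve_le hl1 hl hd3 hfd hr (n := N + e + 4) (by omega)
    have e2 := hilbertFunction_anti hle (N + e + 4)
    have e3 := step (N + 3 + e)
    have e4 := hKle (N + 3)
    rw [hN _ (by omega)] at e3
    rw [show N + 3 + e + 1 = N + e + 4 by ring] at e3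
    omega
  have hcurve := le_planeCurve_of_hilbertFunction (hI.sup_span hl1) hl1 hl hfd hr hle
    (N := N + e + 4) (B := e) (fun n hn => by
      obtain ⟨m, rfl⟩ := Nat.exists_eq_add_of_le' (show e + 4 ≤ n by omega)
      have e1 := hilbertFunction_planeQuartic hl1 hl hfd hr (m + e)
      have e2 := step (m + 3 + e)
      have e3 := hKle (m + 3)
      rw [hN _ (by omega)] at e2
      rw [show m + 3 + e + 1 = m + (e + 4) by ring] at e2
      rw [show m + e + 4 = m + (e + 4) by ring] at e1
      omega)
  have hsup : I ⊔ Ideal.span {l} = Ideal.span {l} ⊔ Ideal.span {f} := le_antisymm hcurve hle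
  -- The constant is the difference between 4(m + 4) and the value 4m + 14 of a plane quartic in
  -- degree m + 4.
  have hK2 : ∀ n ≥ N + 3, hilbertFunction (colonBy I l) n = 2 := by
    intro n hn
    obtain ⟨m, rfl⟩ := Nat.exists_eq_add_of_le' (show 3 ≤ n by omega)
    have e1 := hilbertFunction_planeQuartic hl1 hl hfd hr m
    have e2 := step (m + 3)
    rw [hN _ (by omega), hsup, show m + 3 + 1 = m + 4 by ring, e1] at e2
    omega
  obtain ⟨q, hq2, hq, hKq⟩ := eq_span_triple_of_hilbertFunction hKhom (hsat.colonBy l) h1 h2 h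
    (hleK (Ideal.subset_span (by simp))) (hleK (Ideal.subset_span (by simp))) hK2
  refine ⟨q, f, hq2, hq, hfd, ?_, hr, ?_⟩
  · rw [← hKq]
    exact le_colonBy I l hfI
  · rw [← hKq]
    exact eq_mul_colonBy_sup hfI hcurve

/-! ### The converse: ideals `l(l₁, l₂, q) + (p)` -/

section Converse

variable {l l₁ l₂ q p : CoordRing k}

/-- If `l * a` equals an element of `l(l₁, l₂, q)` plus `c * p`, then `l` divides `c` because `(l)`
is prime; after cancelling `l`, the condition `p ∈ (l₁, l₂, q)` finishes. -/
theorem colonBy_planeQuartic (hl1 : l.IsHomogeneous 1) (hl : l ≠ 0)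
    (hp : p ∈ Ideal.span {l₁, l₂, q}) (hpl : p ∉ Ideal.span {l}) (a : CoordRing k) :
    l * a ∈ Ideal.span {l} * Ideal.span {l₁, l₂, q} ⊔ Ideal.span {p} ↔
      a ∈ Ideal.span {l₁, l₂, q} := by
  constructor
  · intro ha
    obtain ⟨x, hx, y, hy, he⟩ := Submodule.mem_sup.1 ha
    obtain ⟨b, hb, rfl⟩ := Ideal.mem_span_singleton_mul.1 hx
    obtain ⟨c, rfl⟩ := Ideal.mem_span_singleton'.1 hy
    have h1 : c * p ∈ Ideal.span {l} :=
      Ideal.mem_span_singleton.2 ⟨a - b, by linear_combination he⟩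
    obtain ⟨c', rfl⟩ := Ideal.mem_span_singleton.1
      (((isPrime_span_linear hl1 hl).mem_or_mem h1).resolve_right hpl)
    have h2 : a = b + c' * p := by
      apply mul_left_cancel₀ hl
      linear_combination -he
    rw [h2]
    exact add_mem hb (Ideal.mul_mem_left _ _ hp)
  · intro ha
    exact Ideal.mem_sup_left (Ideal.mul_mem_mul (Ideal.mem_span_singleton_self l) ha)

theorem planeQuartic_sup (l l₁ l₂ q p : CoordRing k) :
    Ideal.span {l} * Ideal.span {l₁, l₂, q} ⊔ Ideal.span {p} ⊔ Ideal.span {l} =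
      Ideal.span {l} ⊔ Ideal.span {p} := by
  have h : Ideal.span {l} * Ideal.span {l₁, l₂, q} ≤ Ideal.span {l} := Ideal.mul_le_left
  rw [sup_right_comm, sup_eq_right.2 h]

/-- Both ends of the residual sequence are saturated: `(l, p)` reduces `f` to a multiple `l * a`
modulo `I`, and then `(l₁, l₂, q) = I : l` catches `a`. -/
theorem isSaturated_planeQuartic [IsAlgClosed k] (hl1 : l.IsHomogeneous 1) (hl : l ≠ 0)
    (h1 : l₁.IsHomogeneous 1) (h2 : l₂.IsHomogeneous 1) (h : LinearIndependent k ![l₁, l₂])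
    (hq : q ∉ Ideal.span {l₁, l₂}) (hp : p ∈ Ideal.span {l₁, l₂, q}) (hpl : p ∉ Ideal.span {l}) :
    IsSaturated (Ideal.span {l} * Ideal.span {l₁, l₂, q} ⊔ Ideal.span {p}) := by
  set I := Ideal.span {l} * Ideal.span {l₁, l₂, q} ⊔ Ideal.span {p}
  intro f N hN
  have hle : I ≤ Ideal.span {l} ⊔ Ideal.span {p} := by
    rw [← planeQuartic_sup l l₁ l₂ q p]
    exact le_sup_left
  obtain ⟨x, hx, y, hy, rfl⟩ := Submodule.mem_sup.1
    (isSaturated_planeCurve hl1 hl hpl f N fun g hg => hle (hN g hg))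
  obtain ⟨a, rfl⟩ := Ideal.mem_span_singleton.1 hx
  have hyI : y ∈ I := Ideal.mem_sup_right hy
  refine add_mem ?_ hyI
  rw [colonBy_planeQuartic hl1 hl hp hpl]
  refine isSaturated_span_triple h1 h2 h hq a N fun g hg => ?_
  rw [← colonBy_planeQuartic hl1 hl hp hpl]
  have := sub_mem (hN g hg) (I.mul_mem_left g hyI)
  rwa [mul_add, add_sub_cancel_right, mul_left_comm] at this

theorem isHomogeneousIdeal_planeQuartic (hl1 : l.IsHomogeneous 1) (h1 : l₁.IsHomogeneous 1)
    (h2 : l₂.IsHomogeneous 1) (hq2 : q.IsHomogeneous 2) (hp4 : p.IsHomogeneous 4) :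
    IsHomogeneousIdeal (Ideal.span {l} * Ideal.span {l₁, l₂, q} ⊔ Ideal.span {p}) := by
  rw [span_mul_span_triple, span_triple_eq_sup]
  exact ((isHomogeneousIdeal_span_pair (hl1.mul h1) (hl1.mul h2)).sup_span
    (hl1.mul hq2)).sup_span hp4

theorem hilbertFunction_planeQuartic_union (hl1 : l.IsHomogeneous 1) (hl : l ≠ 0)
    (h1 : l₁.IsHomogeneous 1) (h2 : l₂.IsHomogeneous 1) (h : LinearIndependent k ![l₁, l₂])
    (hq2 : q.IsHomogeneous 2) (hq : q ∉ Ideal.span {l₁, l₂}) (hp4 : p.IsHomogeneous 4)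
    (hp : p ∈ Ideal.span {l₁, l₂, q}) (hpl : p ∉ Ideal.span {l}) (n : ℕ) :
    hilbertFunction (Ideal.span {l} * Ideal.span {l₁, l₂, q} ⊔ Ideal.span {p}) (n + 4) =
      4 * (n + 4) := by
  have e1 := hilbertFunction_sup_span (isHomogeneousIdeal_planeQuartic hl1 h1 h2 hq2 hp4) hl1
    (fun a => (colonBy_planeQuartic hl1 hl hp hpl a).symm) (n + 3)
  rw [planeQuartic_sup, show n + 3 + 1 = n + 4 by ring,
    hilbertFunction_planeQuartic hl1 hl hp4 hpl, show n + 3 = n + 1 + 2 by ring,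
    hilbertFunction_span_triple h1 h2 h hq2 hq] at e1
  omega

theorem hasRegularity_planeQuartic (hl1 : l.IsHomogeneous 1) (hl : l ≠ 0)
    (h1 : l₁.IsHomogeneous 1) (h2 : l₂.IsHomogeneous 1) (h : LinearIndependent k ![l₁, l₂])
    (hq2 : q.IsHomogeneous 2) (hq : q ∉ Ideal.span {l₁, l₂}) (hp4 : p.IsHomogeneous 4)
    (hp : p ∈ Ideal.span {l₁, l₂, q}) (hpl : p ∉ Ideal.span {l}) :
    HasRegularity (Ideal.span {l} * Ideal.span {l₁, l₂, q} ⊔ Ideal.span {p}) 4 := by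
  constructor
  · have e : Ideal.span {l} * Ideal.span {l₁, l₂, q} ⊔ Ideal.span {p} =
        Ideal.span {l * l₁, l * l₂, l * q, p} := by
      rw [span_mul_span_triple]
      simp only [Ideal.span_insert, sup_assoc]
    rw [e]
    exact isRegular_four_of_quartic hl1 hl h1 h2 h hq2 hq hp4 hp hpl
  -- For `m < 4` the generators have degree below that of `p`. They lie in `I + (l) = (l, p)`, hence
  -- in `(l)`, and then so does `p`.
  · rintro m ⟨F, hF⟩
    by_contra! hm
    apply hpl
    refine F.le_of_aug_mem (fun r => ?_) (Ideal.mem_sup_right (Ideal.mem_span_singleton_self p))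
    have hd := hF 0 r
    refine mem_of_mem_sup_span_of_lt (isHomogeneousIdeal_span_singleton hl1) hp4
      (F.aug_homogeneous r) (by push_cast at hd; omega) ?_
    rw [← planeQuartic_sup l l₁ l₂ q p]
    exact Ideal.mem_sup_left (F.aug_mem r)

end Converse

theorem hasHilbertPolynomial_four_mul_iff {I : Ideal (CoordRing k)} :
    HasHilbertPolynomial I (4 * (Polynomial.X : Polynomial ℚ)) ↔
      ∃ N, ∀ n ≥ N, hilbertFunction I n = 4 * n := by
  rw [HasHilbertPolynomial, Filter.eventually_atTop]
  simp only [Polynomial.eval_mul, Polynomial.eval_ofNat, Polynomial.eval_X]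
  norm_cast

end SpaceCurves

end

/-! ### The classification -/

theorem proposition2p2 {k : Type*} [Field k] [IsAlgClosed k] [CharZero k]
    (I : Ideal (SpaceCurves.CoordRing k)) (hI : SpaceCurves.IsHomogeneousIdeal I) :
    (SpaceCurves.IsSaturated I ∧
      SpaceCurves.HasHilbertPolynomial I (4 * (Polynomial.X : Polynomial ℚ)) ∧
      SpaceCurves.HasRegularity I 4) ↔
    ∃ l l₁ l₂ q p : SpaceCurves.CoordRing k,
      l.IsHomogeneous 1 ∧ l ≠ 0 ∧
      l₁.IsHomogeneous 1 ∧ l₂.IsHomogeneous 1 ∧ LinearIndependent k ![l₁, l₂] ∧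
      q.IsHomogeneous 2 ∧ q ∉ Ideal.span {l₁, l₂} ∧
      p.IsHomogeneous 4 ∧ p ∈ Ideal.span {l₁, l₂, q} ∧ p ∉ Ideal.span {l} ∧
      I = Ideal.span {l} * Ideal.span {l₁, l₂, q} ⊔ Ideal.span {p} := by
  open SpaceCurves in
  constructor
  · rintro ⟨hsat, hpoly, hreg⟩
    obtain ⟨N, hN⟩ := hasHilbertPolynomial_four_mul_iff.1 hpoly
    have h3 : ¬ IsRegular I 3 := fun h => by
      have := hreg.2 h
      norm_num at this
    obtain ⟨q₁, q₂, h1, h2, h1I, h2I, hli⟩ := exists_linearIndependent_pair_mem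
      (hilbertFunction_le_four_mul hI hsat hN le_rfl)
    -- A regular sequence would make `I` a complete intersection of two quadrics, which is
    -- 3-regular; only quadrics with a common plane remain.
    by_cases hq : ∀ a, q₂ * a ∈ Ideal.span {q₁} → a ∈ Ideal.span {q₁}
    · refine absurd ?_ h3
      have h0 : q₁ ≠ 0 := hli.ne_zero 0
      rw [eq_completeIntersection hI hN h1 h2 h0 hq h1I h2I]
      exact isRegular_three_of_completeIntersection h1 h2 h0 hq
    · obtain ⟨l, l₁, l₂, hl1, hl, hl₁, hl₂, hind, rfl, rfl⟩ :=
        exists_common_linear_factor h1 h2 hli hq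
      obtain ⟨q, p, hqp⟩ := exists_form_of_common_factor hI hsat hN hreg.1 h3 hl1 hl hl₁ hl₂ hind
        h1I h2I
      exact ⟨l, l₁, l₂, q, p, hl1, hl, hl₁, hl₂, hind, hqp⟩
  · rintro ⟨l, l₁, l₂, q, p, hl1, hl, h1, h2, h, hq2, hq, hp4, hp, hpl, rfl⟩
    refine ⟨isSaturated_planeQuartic hl1 hl h1 h2 h hq hp hpl,
      hasHilbertPolynomial_four_mul_iff.2 ⟨4, fun n hn => ?_⟩,
      hasRegularity_planeQuartic hl1 hl h1 h2 h hq2 hq hp4 hp hpl⟩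
    obtain ⟨m, rfl⟩ := Nat.exists_eq_add_of_le' hn
    exact hilbertFunction_planeQuartic_union hl1 hl h1 h2 h hq2 hq hp4 hp hpl m
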